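/- Let $m\ge 2$. Let $X_m$ be the space of unimodular lattices (lattices of covolume $1$) in $\mathbb{R}^m$, topologized as $\mathrm{SL}_m(\mathbb{R})/\mathrm{SL}_m(\mathbb{Z})$ via $g\mapsto g\mathbb{Z}^m$, and let $m_{X_m}$ be the $\mathrm{SL}_m(\mathbb{R})$-invariant Borel probability measure on $X_m$. For a subgroup $\Lambda<\mathbb{Z}^m$ of finite index $\ell$ put $\bar\Lambda=\ell^{-1/m}\Lambda\in X_m$, and let $C_{\mathbb{Z}^m/\Lambda}(I)$ and $C^+_{\mathbb{Z}^m/\Lambda}(I)$ be the Cayley graph and the Cayley digraph of $\mathbb{Z}^m/\Lambda$ with respect to the image $I$ of the standard basis of $\mathbb{Z}^m$. We refer to the graph as the undirected case and to the digraph as the directed case; $d_{\mathcal G}$ denotes the graph distance of $\mathcal G$, which in the directed case is the non-symmetric distance given by the least length of a directed path. Let $\mathbf B=\{v\in\mathbb{R}^m:\sum_i|v_i|<1\}$ in the undirected case and $\mathbf B=\{v\in\mathbb{R}^m: v_i>0 \text{ for all } i,\ \sum_i v_i<1\}$ in the directed case. Put $d_{\mathbb{R}^m}(x,y)=\inf\{t>0: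 y\in x+t\mathbf B\}\in[0,\infty]$ and $d_{\mathbb{R}^m/L}(x+L,y+L)=\inf_{v\in L}d_{\mathbb{R}^m}(x,y+v)$ for a lattice $L$ in $\mathbb R^m$. Consider one of the following pairs of a metric parameter $\xi$ of a finite graph or digraph $\mathcal G$ with vertex set $V$ and a function $\zeta$ on $X_m$: 1. (both cases) $\xi(\mathcal G)=\operatorname{diam}(\mathcal G)=\max_{x,y\in V}d_{\mathcal G}(x,y)$ and $\zeta(L)=\inf\{t>0: L+t\mathbf B=\mathbb{R}^m\}$; 2. (both cases, for a fixed real $\alpha>0$) $\xi(\mathcal G)=\Bigl(|V|^{-2}\sum_{x,y\in V}d_{\mathcal G}(x,y)^\alpha\Bigr)^{1/\alpha}$ and $\zeta(L)=\Bigl(\lambda(\mathbb{R}^m/L)^{-2}\int_{(\mathbb{R}^m/L)^2}d_{\mathbb{R}^m/L}(x,y)^\alpha\,d\lambda(x)\,d\lambda(y)\Bigr)^{1/\alpha}$, where $\lambda$ is Lebesgue measure; 3. (directed case only) $\xi(\mathcal G)=\operatorname{girth}(\mathcal G)$, the least length of a directed cycle (a loop being a cycle of length $1$), and $\zeta(L)=\inf\{t>0: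 t\mathbf B\cap L \text{ contains a nonzero vector}\}$. For every $i\in\mathbb{N}$ let $\ell_i$ be a positive integer and let $\mathcal A_i$ be a nonempty finite collection of subgroups of $\mathbb{Z}^m$ of index $\ell_i$. Let $\mu_i$ be the normalized counting measure on $\bar{\mathcal A}_i=\{\bar\Lambda:\Lambda\in\mathcal A_i\}\subset X_m$, and assume that $\mu_i\to m_{X_m}$ in the weak-star topology, that is, $\int f\,d\mu_i\to\int f\,dm_{X_m}$ for every continuous $f:X_m\to\mathbb{R}$ with compact support. Define $\xi_i:\bar{\mathcal A}_i\to[0,\infty)$ by $\xi_i(\bar\Lambda)=\ell_i^{-1/m}\,\xi(\mathcal G)$ with $\mathcal G=C_{\mathbb{Z}^m/\Lambda}(I)$ or $\mathcal G=C^+_{\mathbb{Z}^m/\Lambda}(I)$ according to the case. Then $\zeta$ takes values in $(0,\infty)$, and the random variables $\xi_i$ on $(X_m,\mu_i)$ converge in distribution to the random variable $\zeta$ on $(X_m,m_{X_m})$; that is, $(\xi_i)_*\mu_i\to\zeta_*m_{X_m}$ weakly as probability measures on $\mathbb{R}$. -/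

import Mathlib

open MeasureTheory Filter Topology
open scoped ENNReal Pointwise

noncomputable section

namespace TorusGraph

/-! ### Graphs and digraphs -/

/-- The undirected and the directed case. -/
inductive Sense
  | undirected
  | directed

/-- The Cayley digraph of an additive group: an edge `x → x + g` for every `g ∈ S`. -/
def cayleyDigraph {G : Type*} [Add G] (S : Set G) : Digraph G where
  Adj x y := ∃ g ∈ S, x + g = y

/-- `p 0 → p 1 → ⋯ → p n` is a directed walk of length `n` in `D` from `x` to `y`. -/
def IsDirectedWalk {V : Type*} (D : Digraph V) (p : ℕ → V) (n : ℕ) (x y : V) : Prop :=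
  p 0 = x ∧ p n = y ∧ ∀ k < n, D.Adj (p k) (p (k + 1))

/-- The non-symmetric graph distance of a digraph: the least length of a directed walk. -/
def directedDist {V : Type*} (D : Digraph V) (x y : V) : ℕ :=
  sInf {n | ∃ p : ℕ → V, IsDirectedWalk D p n x y}

/-- The girth of a digraph: the least length of a directed cycle. -/
def directedGirth {V : Type*} (D : Digraph V) : ℕ :=
  sInf {n | 0 < n ∧ ∃ (x : V) (p : ℕ → V), IsDirectedWalk D p n x x ∧ Set.InjOn p (Set.Iio n)}

/-- The (ns-)distance between two vertices of the Cayley graph or digraph of `G` w.r.t. `S`. -/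
def cayleyDist {G : Type*} [Add G] (S : Set G) : Sense → G → G → ℕ
  | .undirected => (SimpleGraph.addCayley S).dist
  | .directed => directedDist (cayleyDigraph S)

/-- The metric parameters: the diameter and, for `α > 0`, the (normalized) `α`-th moment of the
distance, both in the undirected and in the directed case; the girth in the directed case. -/
inductive Parameter
  | diameter (σ : Sense)
  | moment (σ : Sense) (α : ℝ) (hα : 0 < α)
  | girth

/-- The value of a metric parameter on the Cayley graph or digraph of the finite group `G`
w.r.t. the generating set `S`. -/
def Parameter.onCayley {G : Type*} [Add G] (S : Set G) : Parameter → ℝ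
  | .diameter σ => ((⨆ q : G × G, cayleyDist S σ q.1 q.2 : ℕ) : ℝ)
  | .moment σ α _ =>
      (((Nat.card G : ℝ) ^ 2)⁻¹ * ∑ᶠ q : G × G, (cayleyDist S σ q.1 q.2 : ℝ) ^ α) ^ (1 / α)
  | .girth => (directedGirth (cayleyDigraph S) : ℝ)

/-- The image in `ℤ^m / Λ` of the standard basis of `ℤ^m`. -/
def standardGenerators {m : ℕ} (Λ : AddSubgroup (Fin m → ℤ)) : Set ((Fin m → ℤ) ⧸ Λ) :=
  Set.range fun i : Fin m ↦ (QuotientAddGroup.mk (Pi.single i 1) : (Fin m → ℤ) ⧸ Λ)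

/-- The value `ξ(𝒢)` of a metric parameter on the approximate torus graph or digraph `𝒢` of `Λ`. -/
def Parameter.onTorusGraph {m : ℕ} (P : Parameter) (Λ : AddSubgroup (Fin m → ℤ)) : ℝ :=
  P.onCayley (standardGenerators Λ)

/-! ### The space of unimodular lattices -/

/-- The space `X_m` of lattices of covolume one in `ℝ^m`. -/
@[ext]
structure UnimodularLattice (m : ℕ) where
  carrier : Submodule ℤ (Fin m → ℝ)
  [discrete : DiscreteTopology carrier]
  [isZLattice : IsZLattice ℝ carrier]
  covolume_eq_one : ZLattice.covolume carrier = 1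

attribute [instance] UnimodularLattice.discrete UnimodularLattice.isZLattice

variable {m : ℕ}

theorem measurePreserving_specialLinear (g : Matrix.SpecialLinearGroup (Fin m) ℝ) :
    MeasurePreserving (Matrix.SpecialLinearGroup.toLin' g).toContinuousLinearEquiv
      (volume : Measure (Fin m → ℝ)) volume := by
  refine ⟨(ContinuousLinearEquiv.continuous _).measurable, ?_⟩
  have h := Real.map_matrix_volume_pi_eq_smul_volume_pi (M := (g : Matrix (Fin m) (Fin m) ℝ))
    (by simp)
  have h2 : (ENNReal.ofReal |(g : Matrix (Fin m) (Fin m) ℝ).det⁻¹|) • (volume : Measure (Fin m → ℝ))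
      = volume := by simp
  rw [h2] at h
  exact h

/-- The action of `SL_m(ℝ)` on `X_m`: the lattice `g L = {v | g⁻¹ v ∈ L}`. -/
def act (g : Matrix.SpecialLinearGroup (Fin m) ℝ) (L : UnimodularLattice m) :
    UnimodularLattice m where
  carrier := ZLattice.comap ℝ L.carrier
    (Matrix.SpecialLinearGroup.toLin' g⁻¹).toContinuousLinearEquiv.toLinearMap
  covolume_eq_one := by
    rw [ZLattice.covolume_comap L.carrier volume volume (measurePreserving_specialLinear g⁻¹)]
    exact L.covolume_eq_one

theorem covolume_span (b : Module.Basis (Fin m) ℝ (Fin m → ℝ)) :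
    ZLattice.covolume (Submodule.span ℤ (Set.range b)) = |(Matrix.of b).det| := by
  rw [ZLattice.covolume_eq_measure_fundamentalDomain _ _ (ZSpan.isAddFundamentalDomain b volume),
    ZSpan.volume_real_fundamentalDomain]

/-- The lattice `ℤ^m`. -/
def standardLattice (m : ℕ) : UnimodularLattice m where
  carrier := Submodule.span ℤ (Set.range (Pi.basisFun ℝ (Fin m)))
  covolume_eq_one := by
    rw [covolume_span]
    have : Matrix.of (Pi.basisFun ℝ (Fin m)) = (1 : Matrix (Fin m) (Fin m) ℝ) := by
      ext i j
      simp [Matrix.one_apply, Pi.single_apply, eq_comm]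
    rw [this]
    simp

/-- The topology of `X_m = SL_m(ℝ) / SL_m(ℤ)`: the quotient topology for `g ↦ g ℤ^m`. -/
instance : TopologicalSpace (UnimodularLattice m) :=
  TopologicalSpace.coinduced
    (fun g : Matrix.SpecialLinearGroup (Fin m) ℝ ↦ act g (standardLattice m)) inferInstance

instance : MeasurableSpace (UnimodularLattice m) := borel _

instance : BorelSpace (UnimodularLattice m) := ⟨rfl⟩

/-! ### Rescaling subgroups of `ℤ^m` -/

/-- The subgroups of `ℤ^m` of index `ℓ`. -/
abbrev IndexSubgroup (m : ℕ) (ℓ : ℕ+) : Type :=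
  {Λ : AddSubgroup (Fin m → ℤ) // Λ.index = ℓ}

/-- The factor `ℓ^{-1/m}`. -/
def scale (m : ℕ) (ℓ : ℕ+) : ℝ := (ℓ : ℝ) ^ (-(1 / (m : ℝ)))

theorem scale_pos (m : ℕ) (ℓ : ℕ+) : 0 < scale m ℓ :=
  Real.rpow_pos_of_pos (by exact_mod_cast ℓ.pos) _

/-- The map `k ↦ ℓ^{-1/m} k` from `ℤ^m` to `ℝ^m`. -/
def scaleHom (m : ℕ) (ℓ : ℕ+) : (Fin m → ℤ) →+ (Fin m → ℝ) where
  toFun k := scale m ℓ • fun i ↦ (k i : ℝ)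
  map_zero' := by ext; simp
  map_add' x y := by ext; simp [mul_add]

theorem scaleHom_injective (m : ℕ) (ℓ : ℕ+) : Function.Injective (scaleHom m ℓ) := by
  intro x y h
  ext i
  have h' : scale m ℓ * (x i : ℝ) = scale m ℓ * (y i : ℝ) := congrFun h i
  exact_mod_cast mul_left_cancel₀ (scale_pos m ℓ).ne' h'

theorem scaleHom_mem_map {ℓ : ℕ+} (Λ : AddSubgroup (Fin m → ℤ)) (k : Fin m → ℤ) :
    scaleHom m ℓ k ∈ Λ.map (scaleHom m ℓ) ↔ k ∈ Λ :=
  AddSubgroup.mem_map_iff_mem (scaleHom_injective m ℓ)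

/-- The basis `ℓ^{-1/m} e_i` of `ℝ^m`. -/
def scaledBasis (m : ℕ) (ℓ : ℕ+) : Module.Basis (Fin m) ℝ (Fin m → ℝ) :=
  (Pi.basisFun ℝ (Fin m)).isUnitSMul (w := fun _ ↦ scale m ℓ)
    fun _ ↦ (scale_pos m ℓ).ne'.isUnit

theorem span_scaledBasis (m : ℕ) (ℓ : ℕ+) :
    (Submodule.span ℤ (Set.range (scaledBasis m ℓ))).toAddSubgroup =
      (⊤ : AddSubgroup (Fin m → ℤ)).map (scaleHom m ℓ) := by
  have hb : ∀ i, scaledBasis m ℓ i = scaleHom m ℓ (Pi.single i 1) := by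
    intro i
    ext j
    simp [scaledBasis, scaleHom, Module.Basis.isUnitSMul_apply, Pi.single_apply]
  ext v
  simp only [Submodule.mem_toAddSubgroup, AddSubgroup.mem_map, AddSubgroup.mem_top, true_and,
    Submodule.mem_span_range_iff_exists_fun]
  refine exists_congr fun k ↦ ?_
  have : ∑ i, k i • scaledBasis m ℓ i = scaleHom m ℓ k := by
    simp_rw [hb, ← map_zsmul, ← map_sum]
    congr 1
    ext j
    simp [Finset.sum_apply, Pi.single_apply]
  rw [this]

/-- The lattice `ℓ^{-1/m} Λ` in `ℝ^m`, for a subgroup `Λ` of `ℤ^m` of index `ℓ`. -/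
def rescaledLattice {ℓ : ℕ+} (Λ : IndexSubgroup m ℓ) : Submodule ℤ (Fin m → ℝ) :=
  AddSubgroup.toIntSubmodule (Λ.1.map (scaleHom m ℓ))

theorem rescaledLattice_le {ℓ : ℕ+} (Λ : IndexSubgroup m ℓ) :
    rescaledLattice Λ ≤ Submodule.span ℤ (Set.range (scaledBasis m ℓ)) := by
  intro v hv
  have hv' : v ∈ (⊤ : AddSubgroup (Fin m → ℤ)).map (scaleHom m ℓ) :=
    AddSubgroup.map_mono le_top hv
  rw [← span_scaledBasis] at hv'
  exact hv'

instance {ℓ : ℕ+} (Λ : IndexSubgroup m ℓ) : DiscreteTopology (rescaledLattice Λ) :=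
  DiscreteTopology.of_subset
    (inferInstanceAs (DiscreteTopology (Submodule.span ℤ (Set.range (scaledBasis m ℓ)))))
    (rescaledLattice_le Λ)

instance {ℓ : ℕ+} (Λ : IndexSubgroup m ℓ) : IsZLattice ℝ (rescaledLattice Λ) where
  span_top := by
    rw [eq_top_iff, ← (scaledBasis m ℓ).span_eq, Submodule.span_le]
    rintro _ ⟨i, rfl⟩
    have h1 : scaledBasis m ℓ i ∈ (⊤ : AddSubgroup (Fin m → ℤ)).map (scaleHom m ℓ) := by
      rw [← span_scaledBasis]
      exact Submodule.subset_span ⟨i, rfl⟩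
    obtain ⟨k, -, hk⟩ := h1
    have h2 : (ℓ : ℕ) • scaledBasis m ℓ i ∈ rescaledLattice Λ := by
      rw [← hk, ← map_nsmul]
      refine ⟨(ℓ : ℕ) • k, ?_, rfl⟩
      have := Λ.1.nsmul_index_mem k
      rwa [Λ.2] at this
    have h3 : scaledBasis m ℓ i = ((ℓ : ℕ) : ℝ)⁻¹ • ((ℓ : ℕ) • scaledBasis m ℓ i) := by
      rw [← Nat.cast_smul_eq_nsmul ℝ, smul_smul, inv_mul_cancel₀ (by exact_mod_cast ℓ.ne_zero),
        one_smul]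
    rw [h3]
    exact Submodule.smul_mem _ _ (Submodule.subset_span h2)

theorem scale_pow_mul {ℓ : ℕ+} (Λ : IndexSubgroup m ℓ) : (ℓ : ℝ) * scale m ℓ ^ m = 1 := by
  rcases Nat.eq_zero_or_pos m with rfl | hm
  · have h : Λ.1.index = 1 := by
      rw [AddSubgroup.index_eq_one]
      exact Subsingleton.elim _ _
    rw [Λ.2] at h
    simp [h]
  · have hℓ : (0 : ℝ) < (ℓ : ℝ) := by exact_mod_cast ℓ.pos
    have hm' : (m : ℝ) ≠ 0 := by exact_mod_cast hm.ne'
    rw [scale, ← Real.rpow_natCast, ← Real.rpow_mul hℓ.le, neg_mul, one_div,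
      inv_mul_cancel₀ hm', Real.rpow_neg_one, mul_inv_cancel₀ hℓ.ne']

/-- The point `Λ̄ = ℓ^{-1/m} Λ` of `X_m`, for a subgroup `Λ` of `ℤ^m` of index `ℓ`. -/
def rescale {ℓ : ℕ+} (Λ : IndexSubgroup m ℓ) : UnimodularLattice m where
  carrier := rescaledLattice Λ
  covolume_eq_one := by
    have h := ZLattice.covolume_div_covolume_eq_relIndex (rescaledLattice Λ) _
      (rescaledLattice_le Λ)
    have hdet : (Matrix.of (scaledBasis m ℓ)).det = scale m ℓ ^ m := by
      have : Matrix.of (scaledBasis m ℓ) = Matrix.diagonal fun _ : Fin m ↦ scale m ℓ := by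
        ext i j
        simp [scaledBasis, Module.Basis.isUnitSMul_apply, Matrix.diagonal_apply, Pi.single_apply,
          eq_comm]
      rw [this]
      simp
    have hidx : (rescaledLattice Λ).toAddSubgroup.relIndex
        (Submodule.span ℤ (Set.range (scaledBasis m ℓ))).toAddSubgroup = ℓ := by
      rw [span_scaledBasis]
      have := AddSubgroup.relIndex_map_map_of_injective Λ.1 ⊤ (scaleHom_injective m ℓ)
      rw [AddSubgroup.relIndex_top_right, Λ.2] at this
      exact this
    have hpos := pow_pos (scale_pos m ℓ) m
    rw [hidx, covolume_span, hdet, abs_of_pos hpos, div_eq_iff hpos.ne', scale_pow_mul Λ] at h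
    exact h

/-- The subgroup `{k ∈ ℤ^m | ℓ^{-1/m} k ∈ L}` of `ℤ^m`; it is `Λ` if `L = Λ̄`. -/
def unscale (ℓ : ℕ+) (L : UnimodularLattice m) : AddSubgroup (Fin m → ℤ) :=
  L.carrier.toAddSubgroup.comap (scaleHom m ℓ)

theorem unscale_rescale {ℓ : ℕ+} (Λ : IndexSubgroup m ℓ) : unscale ℓ (rescale Λ) = Λ.1 :=
  AddSubgroup.comap_map_eq_self_of_injective (scaleHom_injective m ℓ) Λ.1

theorem rescale_injective (ℓ : ℕ+) :
    Function.Injective (rescale : IndexSubgroup m ℓ → UnimodularLattice m) := fun Λ Λ' h ↦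
  Subtype.ext <| by rw [← unscale_rescale Λ, h, unscale_rescale]

/-- The set `{Λ̄ | Λ ∈ 𝒜}`. -/
def rescaledFamily {ℓ : ℕ+} (𝒜 : Finset (IndexSubgroup m ℓ)) : Finset (UnimodularLattice m) :=
  𝒜.map ⟨rescale, rescale_injective ℓ⟩

/-- The random variable `Λ̄ ↦ ℓ^{-1/m} ξ(𝒢)` on `{Λ̄ | Λ ∈ 𝒜}`, with `𝒢` the approximate torus graph
or digraph of `Λ`. (Its values at other points of `X_m` are irrelevant.) -/
def Parameter.onRescaled (P : Parameter) (ℓ : ℕ+) (L : UnimodularLattice m) : ℝ :=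
  scale m ℓ * P.onTorusGraph (unscale ℓ L)

/-! ### The lattice functionals -/

/-- The unit ball of the `ℓ₁`-norm, intersected with the open positive orthant in the directed
case. -/
def ball (m : ℕ) : Sense → Set (Fin m → ℝ)
  | .undirected => {v | ∑ i, |v i| < 1}
  | .directed => {v | (∀ i, 0 < v i) ∧ ∑ i, v i < 1}

/-- The (ns-)distance `inf {t > 0 | y ∈ x + t B}` on `ℝ^m`, infinite if there is no such `t`. -/
def spaceDist (σ : Sense) (x y : Fin m → ℝ) : ℝ≥0∞ :=
  ⨅ (t : ℝ) (_ : 0 < t ∧ y ∈ x +ᵥ t • ball m σ), ENNReal.ofReal t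

/-- The (ns-)distance between `x + L` and `y + L` in the torus `ℝ^m / L`. -/
def torusDist (σ : Sense) (L : Submodule ℤ (Fin m → ℝ)) (x y : Fin m → ℝ) : ℝ≥0∞ :=
  ⨅ v ∈ L, spaceDist σ x (y + v)

/-- A fundamental parallelepiped of `L`; integrals over the torus `ℝ^m / L` are integrals of
`L`-periodic functions over it. -/
def torusDomain (L : Submodule ℤ (Fin m → ℝ)) [DiscreteTopology L] [IsZLattice ℝ L] :
    Set (Fin m → ℝ) :=
  ZSpan.fundamentalDomain ((IsZLattice.basis L).ofZLatticeBasis ℝ L)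

/-- The functional `ζ` on lattices that corresponds to a metric parameter: the covering radius
w.r.t. the ball; the moment of the distance of two random points of the torus; the length of the
shortest nonzero vector of the lattice in the open positive orthant. -/
def Parameter.onLattice (L : Submodule ℤ (Fin m → ℝ)) [DiscreteTopology L] [IsZLattice ℝ L] :
    Parameter → ℝ
  | .diameter σ => sInf {t : ℝ | 0 < t ∧ (L : Set (Fin m → ℝ)) + t • ball m σ = Set.univ}
  | .moment σ α _ =>
      (((volume (torusDomain L) ^ 2)⁻¹ *
        ∫⁻ x in torusDomain L, ∫⁻ y in torusDomain L, torusDist σ L x y ^ α).toReal) ^ (1 / α)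
  | .girth => sInf {t : ℝ | 0 < t ∧ ∃ v ∈ L, v ≠ 0 ∧ v ∈ t • ball m .directed}

/-- The functional `ζ` on `X_m`. -/
def Parameter.onUnimodular (P : Parameter) (L : UnimodularLattice m) : ℝ :=
  P.onLattice L.carrier

/-! ### Measures -/

/-- The normalized counting measure on a nonempty finite set. -/
def normalizedCounting {X : Type*} [MeasurableSpace X] (s : Finset X) (_ : s.Nonempty) :
    Measure X :=
  (s.card : ℝ≥0∞)⁻¹ • ∑ x ∈ s, Measure.dirac x

instance {X : Type*} [MeasurableSpace X] (s : Finset X) (hs : s.Nonempty) :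
    IsProbabilityMeasure (normalizedCounting s hs) where
  measure_univ := by
    simp [normalizedCounting, ENNReal.inv_mul_cancel, hs.ne_empty]

theorem rescaledFamily_nonempty {ℓ : ℕ+} {𝒜 : Finset (IndexSubgroup m ℓ)} (h : 𝒜.Nonempty) :
    (rescaledFamily 𝒜).Nonempty :=
  Finset.map_nonempty.2 h

/-- The normalized counting measure on `{Λ̄ | Λ ∈ 𝒜}`. -/
def familyMeasure {ℓ : ℕ+} (𝒜 : Finset (IndexSubgroup m ℓ)) (h : 𝒜.Nonempty) :
    Measure (UnimodularLattice m) :=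
  normalizedCounting (rescaledFamily 𝒜) (rescaledFamily_nonempty h)

instance {ℓ : ℕ+} (𝒜 : Finset (IndexSubgroup m ℓ)) (h : 𝒜.Nonempty) :
    IsProbabilityMeasure (familyMeasure 𝒜 h) :=
  inferInstanceAs (IsProbabilityMeasure (normalizedCounting _ _))

/-- Weak-star convergence: convergence of the integrals of all continuous functions with compact
support. -/
def WeakStarTendsto {X : Type*} [TopologicalSpace X] [MeasurableSpace X] (μ : ℕ → Measure X)
    (ν : Measure X) : Prop :=
  ∀ f : X → ℝ, Continuous f → HasCompactSupport f →
    Tendsto (fun i ↦ ∫ x, f x ∂μ i) atTop (𝓝 (∫ x, f x ∂ν))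

end TorusGraph

end

open TorusGraph

noncomputable section

namespace TorusGraph

open Matrix

/-! ### The topology of the space of lattices -/

section Space

variable {m : ℕ}

/-! The Cayley graph of `ℤ^m / Λ`, rescaled by `s = ℓ^{-1/m}`, is a discretization of the torus `ℝ^m
/ Λ̄` with mesh `s`. A path in the graph lifts to a path in `ℤ^m`, so graph distances are `ℓ₁`-norms
of integral vectors (nonnegative ones in the directed case) minimized over a coset of `Λ`, exactly
as torus distances are `ℓ₁`-norms minimized over a coset of `Λ̄`. Rounding points of the torus to
vertices changes the rescaled distance by at most `m * s` (`cost_rescale_le`, `le_cost_rescale`).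
Hence diameters and moments of the graphs are close to those of the tori, uniformly where the
covering radius is bounded, and the limit functionals are continuous on `X_m` because a matrix near
`1` distorts all distances only slightly.

The girth is different: the graph minimizes over lattice vectors in the closed orthant, the limit
functional over the open one. The two agree, without error, unless the lattice has a short nonzero
vector in a coordinate hyperplane. Such lattices form a closed set (`isClosed_degenerate`), which is
null by invariance under a suitable family of shears (`measure_degenerate`); off it the girth
functional is continuous.

The mesh tends to `0` because a family of bounded index would consist of such degenerate lattices,
contradicting convergence to a measure that does not charge them (`tendsto_scale`). Finally,
weak-star convergence only tests compactly supported functions; since the limit is a probability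
measure no mass escapes, and a cutoff inside the set of continuity yields convergence in
distribution (`tendstoInDistribution_of_weakStarTendsto`). -/

theorem mem_act {g : SpecialLinearGroup (Fin m) ℝ} {L : UnimodularLattice m} {v : Fin m → ℝ} :
    v ∈ (act g L).carrier ↔ (g⁻¹).1 *ᵥ v ∈ L.carrier :=
  Iff.rfl

theorem coe_mul_mulVec (g h : SpecialLinearGroup (Fin m) ℝ) (v : Fin m → ℝ) :
    (g * h).1 *ᵥ v = g.1 *ᵥ (h.1 *ᵥ v) :=
  (mulVec_mulVec v g.1 h.1).symm

theorem coe_one_mulVec (v : Fin m → ℝ) :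
    (1 : SpecialLinearGroup (Fin m) ℝ).1 *ᵥ v = v :=
  one_mulVec v

theorem coe_inv_mulVec_mulVec (g : SpecialLinearGroup (Fin m) ℝ) (v : Fin m → ℝ) :
    (g⁻¹).1 *ᵥ (g.1 *ᵥ v) = v := by
  rw [← coe_mul_mulVec, inv_mul_cancel, coe_one_mulVec]

theorem mulVec_coe_inv_mulVec (g : SpecialLinearGroup (Fin m) ℝ) (v : Fin m → ℝ) :
    g.1 *ᵥ ((g⁻¹).1 *ᵥ v) = v := by
  simpa using coe_inv_mulVec_mulVec g⁻¹ v

theorem mulVec_mem_act {g : SpecialLinearGroup (Fin m) ℝ} {L : UnimodularLattice m}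
    {v : Fin m → ℝ} : g.1 *ᵥ v ∈ (act g L).carrier ↔ v ∈ L.carrier := by
  rw [mem_act, coe_inv_mulVec_mulVec]

theorem act_mul (g h : SpecialLinearGroup (Fin m) ℝ) (L : UnimodularLattice m) :
    act (g * h) L = act g (act h L) := by
  ext v
  rw [mem_act, mem_act, mem_act, _root_.mul_inv_rev, coe_mul_mulVec]

theorem act_one (L : UnimodularLattice m) : act 1 L = L := by
  ext v
  rw [mem_act, inv_one, coe_one_mulVec]

theorem act_inv_act (g : SpecialLinearGroup (Fin m) ℝ) (L : UnimodularLattice m) :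
    act g⁻¹ (act g L) = L := by
  rw [← act_mul, inv_mul_cancel, act_one]

theorem mem_standardLattice {v : Fin m → ℝ} :
    v ∈ (standardLattice m).carrier ↔ ∀ i, ∃ k : ℤ, (k : ℝ) = v i := by
  change v ∈ Submodule.span ℤ (Set.range (Pi.basisFun ℝ (Fin m))) ↔ _
  rw [Module.Basis.mem_span_iff_repr_mem]
  simp

/-- The orbit map `g ↦ g ℤ^m`. -/
def orbitMap (m : ℕ) (g : SpecialLinearGroup (Fin m) ℝ) : UnimodularLattice m :=
  act g (standardLattice m)

theorem act_orbitMap (g h : SpecialLinearGroup (Fin m) ℝ) :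
    act g (orbitMap m h) = orbitMap m (g * h) :=
  (act_mul g h _).symm

theorem mem_orbitMap {g : SpecialLinearGroup (Fin m) ℝ} {v : Fin m → ℝ} :
    v ∈ (orbitMap m g).carrier ↔ (g⁻¹).1 *ᵥ v ∈ (standardLattice m).carrier :=
  mem_act

/-- `g ℤ^m = h ℤ^m` iff `g⁻¹ h` and its inverse have integral entries. -/
theorem orbitMap_eq_iff {g h : SpecialLinearGroup (Fin m) ℝ} :
    orbitMap m g = orbitMap m h ↔
      ∀ i j, (∃ k : ℤ, (k : ℝ) = (g⁻¹ * h).1 i j) ∧ ∃ k : ℤ, (k : ℝ) = (h⁻¹ * g).1 i j := by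
  have key : ∀ a : SpecialLinearGroup (Fin m) ℝ,
      (∀ v ∈ (standardLattice m).carrier, a.1 *ᵥ v ∈ (standardLattice m).carrier) ↔
        ∀ i j, ∃ k : ℤ, (k : ℝ) = a.1 i j := by
    intro a
    constructor
    · intro H i j
      have := H (Pi.single j 1) (mem_standardLattice.2 fun i ↦ by
        by_cases h : i = j
        · subst h; exact ⟨1, by simp⟩
        · exact ⟨0, by simp [h]⟩)
      simpa using mem_standardLattice.1 this i
    · intro H v hv
      rw [mem_standardLattice] at hv ⊢
      choose k hk using hv
      choose a' ha' using H
      intro i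
      refine ⟨∑ j, a' i j * k j, ?_⟩
      simp [mulVec, dotProduct, ha', hk]
  have hle : ∀ a b : SpecialLinearGroup (Fin m) ℝ,
      (∀ v ∈ (orbitMap m b).carrier, v ∈ (orbitMap m a).carrier) ↔
        ∀ i j, ∃ k : ℤ, (k : ℝ) = (a⁻¹ * b).1 i j := by
    intro a b
    rw [← key]
    constructor
    · intro H v hv
      have := H (b.1 *ᵥ v) (by rwa [mem_orbitMap, coe_inv_mulVec_mulVec])
      rwa [mem_orbitMap, ← coe_mul_mulVec] at this
    · intro H v hv
      rw [mem_orbitMap] at hv ⊢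
      have := H _ hv
      rwa [← coe_mul_mulVec, mul_assoc, mul_inv_cancel, mul_one] at this
  have hand : (∀ i j, (∃ k : ℤ, (k : ℝ) = (g⁻¹ * h).1 i j) ∧ ∃ k : ℤ, (k : ℝ) = (h⁻¹ * g).1 i j) ↔
      (∀ i j, ∃ k : ℤ, (k : ℝ) = (g⁻¹ * h).1 i j) ∧ ∀ i j, ∃ k : ℤ, (k : ℝ) = (h⁻¹ * g).1 i j :=
    ⟨fun H ↦ ⟨fun i j ↦ (H i j).1, fun i j ↦ (H i j).2⟩, fun H i j ↦ ⟨H.1 i j, H.2 i j⟩⟩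
  rw [hand, ← hle, ← hle]
  constructor
  · intro h
    rw [h]
    simp
  · intro h
    ext v
    exact ⟨h.2 v, h.1 v⟩

theorem continuous_orbitMap : Continuous (orbitMap m) :=
  continuous_coinduced_rng

/-- Covolume one gives a `ℤ`-basis of determinant `±1`; negating one basis vector corrects the sign
without changing the lattice. The columns of `g` are the basis vectors. -/
theorem surjective_orbitMap (hm : 0 < m) : Function.Surjective (orbitMap m) := by
  intro L
  let b := (IsZLattice.basis L.carrier).ofZLatticeBasis ℝ L.carrier
  have hspan : Submodule.span ℤ (Set.range b) = L.carrier :=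
    Module.Basis.ofZLatticeBasis_span ℝ _ _
  have hdet : |(Matrix.of b).det| = 1 := by
    rw [← covolume_span b]
    have := L.covolume_eq_one
    simp only [← hspan] at this
    exact this
  obtain ⟨c, hc, hcL⟩ : ∃ c : Matrix (Fin m) (Fin m) ℝ, c.det = 1 ∧
      ∀ v, v ∈ L.carrier ↔ ∃ k : Fin m → ℤ, v = ∑ i, (k i : ℝ) • c i := by
    have hb : ∀ v, v ∈ L.carrier ↔ ∃ k : Fin m → ℤ, v = ∑ i, (k i : ℝ) • b i := by
      intro v
      rw [← hspan, Submodule.mem_span_range_iff_exists_fun]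
      simp [eq_comm, ← Int.cast_smul_eq_zsmul ℝ]
    rcases (abs_eq zero_le_one).1 hdet with h | h
    · exact ⟨_, h, hb⟩
    · refine ⟨(Matrix.of b).updateRow ⟨0, hm⟩ ((-1 : ℝ) • b ⟨0, hm⟩), ?_, fun v ↦ (hb v).trans ?_⟩
      · rw [det_updateRow_smul]
        have : (Matrix.of b).updateRow ⟨0, hm⟩ (b ⟨0, hm⟩) = Matrix.of b :=
          updateRow_eq_self _ _
        rw [this, h]
        norm_num
      · let e : (Fin m → ℤ) → Fin m → ℤ := fun k i ↦ if i = ⟨0, hm⟩ then - k i else k i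
        have he : ∀ k, ∑ i, (e k i : ℝ) •
            (Matrix.of b).updateRow ⟨0, hm⟩ ((-1 : ℝ) • b ⟨0, hm⟩) i = ∑ i, (k i : ℝ) • b i := by
          intro k
          refine Finset.sum_congr rfl fun i _ ↦ ?_
          by_cases hi : i = ⟨0, hm⟩
          · subst hi
            simp [e]
          · simp only [e, hi, if_false, ne_eq, not_false_eq_true, updateRow_ne]
            rfl
        have hee : ∀ k, e (e k) = k := by
          intro k
          ext i
          by_cases hi : i = ⟨0, hm⟩ <;> simp [e, hi]
        constructor
        · rintro ⟨k, hk⟩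
          exact ⟨e k, by rw [he, hk]⟩
        · rintro ⟨k, hk⟩
          exact ⟨e k, by rw [← he, hee, hk]⟩
  let g : SpecialLinearGroup (Fin m) ℝ := ⟨cᵀ, by rw [det_transpose, hc]⟩
  refine ⟨g, ?_⟩
  ext v
  have hg : ∀ w : Fin m → ℝ, g.1 *ᵥ w = ∑ i, w i • c i := by
    intro w
    ext j
    simp [g, mulVec, dotProduct, mul_comm]
  rw [hcL, mem_orbitMap, mem_standardLattice]
  constructor
  · intro h
    choose k hk using h
    refine ⟨k, ?_⟩
    simp_rw [hk]
    rw [← hg, mulVec_coe_inv_mulVec]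
  · rintro ⟨k, rfl⟩ i
    have := hg fun i ↦ (k i : ℝ)
    rw [← this, coe_inv_mulVec_mulVec]
    exact ⟨k i, rfl⟩

/-- The saturation of `U` is the union of its right translates by the stabilizer of `ℤ^m`. -/
theorem isOpenMap_orbitMap : IsOpenMap (orbitMap m) := by
  intro U hU
  change IsOpen (orbitMap m ⁻¹' (orbitMap m '' U))
  have : orbitMap m ⁻¹' (orbitMap m '' U) =
      ⋃ γ ∈ {γ : SpecialLinearGroup (Fin m) ℝ | act γ (standardLattice m) = standardLattice m},
        (fun g ↦ g * γ) ⁻¹' U := by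
    ext g
    simp only [Set.mem_preimage, Set.mem_image, Set.mem_iUnion, Set.mem_ofPred_eq, exists_prop]
    constructor
    · rintro ⟨h, hh, hgh⟩
      refine ⟨g⁻¹ * h, ?_, by simpa using hh⟩
      rw [act_mul]
      change act g⁻¹ (orbitMap m h) = _
      rw [hgh]
      exact act_inv_act _ _
    · rintro ⟨γ, hγ, h⟩
      refine ⟨_, h, ?_⟩
      rw [orbitMap, act_mul, hγ]
      rfl
  rw [this]
  exact isOpen_biUnion fun γ _ ↦ hU.preimage (continuous_id.mul continuous_const)

theorem isOpenQuotientMap_orbitMap (hm : 0 < m) : IsOpenQuotientMap (orbitMap m) :=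
  ⟨surjective_orbitMap hm, continuous_orbitMap, isOpenMap_orbitMap⟩

theorem isClosed_range_intCast : IsClosed {x : ℝ | ∃ k : ℤ, (k : ℝ) = x} :=
  Int.isClosedEmbedding_coe_real.isClosed_range

/-- For an open quotient map, Hausdorffness means that the relation is closed; here it says that
certain continuous matrix entries lie in the closed set `ℤ`. -/
theorem t2Space_unimodularLattice (hm : 0 < m) : T2Space (UnimodularLattice m) := by
  rw [t2Space_iff_of_isOpenQuotientMap (isOpenQuotientMap_orbitMap hm)]
  simp only [orbitMap_eq_iff]
  simp only [Set.ofPred_forall, Set.ofPred_and]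
  have hc : ∀ i j, Continuous fun g : SpecialLinearGroup (Fin m) ℝ ↦ g.1 i j := fun i j ↦
    (continuous_apply_apply i j).comp continuous_subtype_val
  refine isClosed_iInter fun i ↦ isClosed_iInter fun j ↦ IsClosed.inter ?_ ?_
  · exact isClosed_range_intCast.preimage ((hc i j).comp (by fun_prop))
  · exact isClosed_range_intCast.preimage ((hc i j).comp (by fun_prop))

theorem isClosed_range_coe_specialLinear :
    IsClosed (Set.range (Subtype.val : SpecialLinearGroup (Fin m) ℝ → _)) := by
  have : Set.range (Subtype.val : SpecialLinearGroup (Fin m) ℝ → _) =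
      {A : Matrix (Fin m) (Fin m) ℝ | A.det = 1} := Subtype.range_coe
  rw [this]
  exact isClosed_eq (by fun_prop) continuous_const

theorem locallyCompactSpace_specialLinear :
    LocallyCompactSpace (SpecialLinearGroup (Fin m) ℝ) := by
  have : LocallyCompactSpace (Matrix (Fin m) (Fin m) ℝ) :=
    inferInstanceAs (LocallyCompactSpace (Fin m → Fin m → ℝ))
  exact (IsClosedEmbedding.mk .subtypeVal isClosed_range_coe_specialLinear).locallyCompactSpace

theorem secondCountableTopology_specialLinear :
    SecondCountableTopology (SpecialLinearGroup (Fin m) ℝ) := by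
  have : SecondCountableTopology (Matrix (Fin m) (Fin m) ℝ) :=
    inferInstanceAs (SecondCountableTopology (Fin m → Fin m → ℝ))
  exact IsEmbedding.subtypeVal.secondCountableTopology

theorem locallyCompactSpace_unimodularLattice (hm : 0 < m) :
    LocallyCompactSpace (UnimodularLattice m) :=
  have := locallyCompactSpace_specialLinear (m := m)
  (isOpenQuotientMap_orbitMap hm).locallyCompactSpace

/-- Every open set of `X_m` is an increasing union of compact sets. -/
theorem exists_isCompact_iUnion_eq (hm : 0 < m) {U : Set (UnimodularLattice m)} (hU : IsOpen U) :
    ∃ K : ℕ → Set (UnimodularLattice m), (∀ n, IsCompact (K n)) ∧ Monotone K ∧ ⋃ n, K n = U := by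
  have := locallyCompactSpace_specialLinear (m := m)
  have := secondCountableTopology_specialLinear (m := m)
  have hV : IsOpen (orbitMap m ⁻¹' U) := hU.preimage continuous_orbitMap
  have : LocallyCompactSpace (orbitMap m ⁻¹' U) := hV.locallyCompactSpace
  refine ⟨fun n ↦ orbitMap m '' (Subtype.val '' compactCovering (orbitMap m ⁻¹' U) n),
    fun n ↦ ((isCompact_compactCovering _ n).image continuous_subtype_val).image
      continuous_orbitMap, fun a b h ↦ ?_, ?_⟩
  · exact Set.image_mono (Set.image_mono (compactCovering_subset _ h))
  · rw [← Set.image_iUnion, ← Set.image_iUnion, iUnion_compactCovering, Set.image_univ,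
      Subtype.range_coe, Set.image_preimage_eq _ (surjective_orbitMap hm)]

theorem continuous_act (g : SpecialLinearGroup (Fin m) ℝ) :
    Continuous (act g : UnimodularLattice m → _) := by
  refine continuous_coinduced_dom.2 ?_
  have : act g ∘ (fun h : SpecialLinearGroup (Fin m) ℝ ↦ act h (standardLattice m)) =
      fun h ↦ orbitMap m (g * h) := by
    ext1 h
    exact act_orbitMap g h
  rw [this]
  exact continuous_orbitMap.comp (continuous_const.mul continuous_id)

/-- The neighbourhoods of `L` are those of the form `{k L | k ∈ V}`, with `V` a neighbourhood
of `1`. -/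
theorem nhds_eq_map_act (hm : 0 < m) (L : UnimodularLattice m) :
    𝓝 L = Filter.map (fun k : SpecialLinearGroup (Fin m) ℝ ↦ act k L) (𝓝 1) := by
  obtain ⟨g, rfl⟩ := surjective_orbitMap hm L
  have h1 : Filter.map (orbitMap m) (𝓝 g) = 𝓝 (orbitMap m g) :=
    isOpenMap_orbitMap.map_nhds_eq continuous_orbitMap.continuousAt
  have h2 : Filter.map (fun k ↦ k * g) (𝓝 (1 : SpecialLinearGroup (Fin m) ℝ)) = 𝓝 g := by
    rw [map_mul_right_nhds, one_mul]
  rw [← h1, ← h2, Filter.map_map]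
  simp only [act_orbitMap]
  rfl

theorem eventually_nhds_iff (hm : 0 < m) {L : UnimodularLattice m}
    {P : UnimodularLattice m → Prop} :
    (∀ᶠ L' in 𝓝 L, P L') ↔
      ∀ᶠ k : SpecialLinearGroup (Fin m) ℝ in 𝓝 1, P (act k L) := by
  rw [nhds_eq_map_act hm, eventually_map]

theorem tendsto_mulVec (v : Fin m → ℝ) :
    Tendsto (fun k : SpecialLinearGroup (Fin m) ℝ ↦ k.1 *ᵥ v) (𝓝 1) (𝓝 v) := by
  have hc : Continuous fun k : SpecialLinearGroup (Fin m) ℝ ↦ k.1 *ᵥ v :=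
    continuous_subtype_val.matrix_mulVec continuous_const
  simpa using hc.tendsto 1

end Space

/-! ### A criterion for convergence in distribution -/

section Criterion

variable {X : Type*} [MeasurableSpace X]

theorem integrable_normalizedCounting [MeasurableSingletonClass X] {s : Finset X}
    (hs : s.Nonempty) (f : X → ℝ) : Integrable f (normalizedCounting s hs) := by
  refine Integrable.smul_measure ?_ (by simpa using hs.ne_empty)
  exact integrable_finsetSum_measure.2 fun x _ ↦ integrable_dirac (by finiteness)

theorem ae_mem_normalizedCounting [MeasurableSingletonClass X] {s : Finset X}
    (hs : s.Nonempty) : ∀ᵐ x ∂normalizedCounting s hs, x ∈ s := by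
  refine Measure.ae_smul_measure ?_ _
  rw [ae_finsetSum_measure_iff]
  intro x hx
  rwa [ae_dirac_eq, Filter.eventually_pure]

/-- Weak-star convergence of normalized counting measures on the sets `s i` to `μ`, together with
locally uniform convergence on large open sets of `ξ i` to a continuous limit,
implies convergence in distribution. -/
theorem tendstoInDistribution_of_weakStarTendsto [TopologicalSpace X] [BorelSpace X] [T2Space X]
    [LocallyCompactSpace X] {μ : Measure X} [IsProbabilityMeasure μ] {s : ℕ → Finset X}
    (hs : ∀ i, (s i).Nonempty)
    (hconv : WeakStarTendsto (fun i ↦ normalizedCounting (s i) (hs i)) μ)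
    {ζ : X → ℝ} {ξ : ℕ → X → ℝ} (hζ : Measurable ζ)
    (H : ∀ ε > 0, ∃ U K : Set X, IsOpen U ∧ IsCompact K ∧ K ⊆ U ∧ 1 - ε ≤ μ.real K ∧
      ContinuousOn ζ U ∧ ∀ K' ⊆ U, IsCompact K' → ∀ δ > 0, ∀ᶠ i in atTop, ∀ x ∈ s i, x ∈ K' →
        |ξ i x - ζ x| ≤ δ) :
    TendstoInDistribution ξ atTop ζ (fun i ↦ normalizedCounting (s i) (hs i)) μ := by
  have hξ : ∀ i, AEMeasurable (ξ i) (normalizedCounting (s i) (hs i)) := fun i ↦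
    (integrable_normalizedCounting (hs i) (ξ i)).aemeasurable
  refine ⟨hξ, hζ.aemeasurable, ?_⟩
  refine tendsto_iff_forall_lipschitz_integral_tendsto.2 ?_
  rintro f ⟨C, hC⟩ ⟨A, hA⟩
  have hfc : Continuous f := hA.continuous
  obtain ⟨M, hM0, hM⟩ : ∃ M > 0, ∀ x, |f x| ≤ M := by
    refine ⟨|f 0| + |C| + 1, by positivity, fun x ↦ ?_⟩
    have h1 := hC x 0
    rw [Real.dist_eq] at h1
    have h2 : |f x| ≤ |f x - f 0| + |f 0| := by simpa using abs_add_le (f x - f 0) (f 0)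
    have := le_abs_self C
    linarith
  have hlim : ∫ y, f y ∂(μ.map ζ) = ∫ x, f (ζ x) ∂μ :=
    integral_map hζ.aemeasurable hfc.aestronglyMeasurable
  have hpre : ∀ i, ∫ y, f y ∂((normalizedCounting (s i) (hs i)).map (ξ i)) =
      ∫ x, f (ξ i x) ∂(normalizedCounting (s i) (hs i)) := fun i ↦
    integral_map (hξ i) hfc.aestronglyMeasurable
  simp only [ProbabilityMeasure.coe_mk, hlim, hpre]
  rw [Metric.tendsto_atTop]
  intro η hη
  set ε : ℝ := η / (8 * M) with hε
  have hε0 : 0 < ε := by positivity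
  have hMε : M * ε = η / 8 := by
    rw [hε]
    field_simp
  obtain ⟨U, K, hU, hK, hKU, hμK, hζU, hclose⟩ := H ε hε0
  -- The cutoff `φ` makes `f ∘ ζ` an admissible test function; it loses mass at most `ε` under `μ`,
  -- hence at most `2 * ε` under the approximating measures eventually.
  obtain ⟨φ, hφK, hφc, hφU, hφ⟩ := exists_continuousMap_one_of_isCompact_subset_isOpen hK hU hKU
  set δ : ℝ := η / (8 * (A + 1)) with hδ
  have hδ0 : 0 < δ := by positivity
  have hAδ : (A + 1) * δ = η / 8 := by
    rw [hδ]
    field_simp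
  have hφint : Integrable φ μ := φ.continuous.integrable_of_hasCompactSupport hφc
  have hφμ : 1 - ε ≤ ∫ x, φ x ∂μ := by
    refine hμK.trans ?_
    rw [← integral_indicator_one hK.measurableSet]
    refine integral_mono ((integrable_const (1 : ℝ)).indicator hK.measurableSet) hφint fun x ↦ ?_
    by_cases hx : x ∈ K
    · simp [hx, hφK hx]
    · simpa [hx] using (hφ x).1
  -- `ζ` is continuous only on `U`, but off the support of `φ` the product vanishes locally.
  have hψc : Continuous fun x ↦ φ x * f (ζ x) := by
    rw [continuous_iff_continuousAt]
    intro x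
    by_cases hx : x ∈ tsupport φ
    · exact φ.continuous.continuousAt.mul
        (hfc.continuousAt.comp (hζU.continuousAt (hU.mem_nhds (hφU hx))))
    · have : (fun x ↦ φ x * f (ζ x)) =ᶠ[𝓝 x] fun _ ↦ 0 := by
        filter_upwards [(isClosed_tsupport φ).isOpen_compl.mem_nhds hx] with y hy
        rw [image_eq_zero_of_notMem_tsupport hy, zero_mul]
      exact continuousAt_const.congr this.symm
  have hψs : HasCompactSupport fun x ↦ φ x * f (ζ x) := HasCompactSupport.mul_right hφc
  have h1 := hconv φ φ.continuous hφc
  have h2 := hconv _ hψc hψs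
  have h3 := hclose _ hφU hφc δ hδ0
  have h1' := (tendsto_order.1 h1).1 (1 - 2 * ε) (by linarith)
  have h2' := (Metric.tendsto_nhds.1 h2) (η / 8) (by positivity)
  have hmain : ∀ᶠ i in atTop, dist (∫ x, f (ξ i x) ∂(normalizedCounting (s i) (hs i)))
      (∫ x, f (ζ x) ∂μ) < η := by
    filter_upwards [h1', h2', h3] with i hi1 hi2 hi3
    set ν := normalizedCounting (s i) (hs i)
    have hint : ∀ g : X → ℝ, Integrable g ν := integrable_normalizedCounting (hs i)
    have e1 : |∫ x, f (ξ i x) ∂ν - ∫ x, φ x * f (ζ x) ∂ν| ≤ η / 8 + M * (2 * ε) := by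
      rw [← integral_sub (hint _) (hint _)]
      refine (abs_integral_le_integral_abs).trans ?_
      have : ∫ x, |f (ξ i x) - φ x * f (ζ x)| ∂ν ≤ ∫ x, (η / 8 + M * (1 - φ x)) ∂ν := by
        refine integral_mono_ae (hint _) (hint _) ?_
        filter_upwards [ae_mem_normalizedCounting (hs i)] with x hx
        have hφ0 := (hφ x).1
        have hφ1 := (hφ x).2
        have hsplit : f (ξ i x) - φ x * f (ζ x) =
          φ x * (f (ξ i x) - f (ζ x)) + (1 - φ x) * f (ξ i x) := by ring
        rw [hsplit]
        refine (abs_add_le _ _).trans (add_le_add ?_ ?_)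
        · rw [abs_mul, abs_of_nonneg hφ0]
          by_cases hxs : x ∈ tsupport φ
          · have hd := hi3 x hx hxs
            have hl := hA.dist_le_mul (ξ i x) (ζ x)
            rw [Real.dist_eq, Real.dist_eq] at hl
            have hA0 : (0 : ℝ) ≤ A := A.2
            calc φ x * |f (ξ i x) - f (ζ x)| ≤ 1 * (A * δ) := by
                  refine mul_le_mul hφ1 (hl.trans ?_) (abs_nonneg _) zero_le_one
                  exact mul_le_mul_of_nonneg_left hd hA0
              _ ≤ η / 8 := by nlinarith
          · rw [image_eq_zero_of_notMem_tsupport hxs, zero_mul]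
            positivity
        · rw [abs_mul, abs_of_nonneg (by linarith : 0 ≤ 1 - φ x), mul_comm]
          exact mul_le_mul_of_nonneg_right (hM _) (by linarith)
      refine this.trans ?_
      rw [integral_add (hint _) (hint _), integral_const_mul, integral_sub (hint _) (hint _)]
      simp only [integral_const, probReal_univ, smul_eq_mul, one_mul]
      have : M * (1 - ∫ x, φ x ∂ν) ≤ M * (2 * ε) :=
        mul_le_mul_of_nonneg_left (by linarith) hM0.le
      linarith
    have e2 : |∫ x, φ x * f (ζ x) ∂ν - ∫ x, φ x * f (ζ x) ∂μ| < η / 8 := hi2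
    have e3 : |∫ x, φ x * f (ζ x) ∂μ - ∫ x, f (ζ x) ∂μ| ≤ M * ε := by
      have hI1 : Integrable (fun x ↦ φ x * f (ζ x)) μ := hψc.integrable_of_hasCompactSupport hψs
      have hI2 : Integrable (fun x ↦ f (ζ x)) μ :=
        Integrable.of_bound (hfc.measurable.comp hζ).aestronglyMeasurable M
          (Eventually.of_forall fun x ↦ hM _)
      rw [← integral_sub hI1 hI2]
      refine (abs_integral_le_integral_abs).trans ?_
      have : ∫ x, |φ x * f (ζ x) - f (ζ x)| ∂μ ≤ ∫ x, M * (1 - φ x) ∂μ := by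
        refine integral_mono (hI1.sub hI2).abs (((integrable_const _).sub hφint).const_mul _)
          fun x ↦ ?_
        have hφ1 := (hφ x).2
        have hsplit : φ x * f (ζ x) - f (ζ x) = - ((1 - φ x) * f (ζ x)) := by ring
        simp only
        rw [hsplit, abs_neg, abs_mul, abs_of_nonneg (by linarith : 0 ≤ 1 - φ x), mul_comm]
        exact mul_le_mul_of_nonneg_right (hM _) (by linarith)
      refine this.trans ?_
      rw [integral_const_mul, integral_sub (integrable_const _) hφint]
      simp only [integral_const, probReal_univ, smul_eq_mul, one_mul]
      exact mul_le_mul_of_nonneg_left (by linarith) hM0.le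
    rw [Real.dist_eq]
    -- The errors are `η / 8 + η / 4` for `e1` and `η / 8` for each of `e2` and `e3`, in total `5 *
    -- η / 8`.
    have hM2 : M * (2 * ε) = η / 4 := by linarith
    rw [hM2] at e1
    rw [hMε] at e3
    rw [abs_le] at e1 e3
    rw [abs_lt] at e2
    rw [abs_lt]
    constructor <;> linarith [e1.1, e1.2, e2.1, e2.2, e3.1, e3.2]
  exact eventually_atTop.1 hmain

end Criterion

/-! ### Lattices with short vectors in a coordinate hyperplane -/

section Degenerate

variable {m : ℕ}

/-- The `ℓ₁`-norm. -/
def ell1 (v : Fin m → ℝ) : ℝ := ∑ i, |v i|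

theorem ell1_nonneg (v : Fin m → ℝ) : 0 ≤ ell1 v :=
  Finset.sum_nonneg fun _ _ ↦ abs_nonneg _

theorem abs_le_ell1 (v : Fin m → ℝ) (i : Fin m) : |v i| ≤ ell1 v :=
  Finset.single_le_sum (f := fun i ↦ |v i|) (fun _ _ ↦ abs_nonneg _) (Finset.mem_univ i)

theorem ell1_add_le (v w : Fin m → ℝ) : ell1 (v + w) ≤ ell1 v + ell1 w := by
  rw [ell1, ell1, ell1, ← Finset.sum_add_distrib]
  exact Finset.sum_le_sum fun i _ ↦ abs_add_le _ _

theorem ell1_neg (v : Fin m → ℝ) : ell1 (-v) = ell1 v := by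
  simp [ell1]

theorem ell1_smul (c : ℝ) (v : Fin m → ℝ) : ell1 (c • v) = |c| * ell1 v := by
  simp [ell1, abs_mul, Finset.mul_sum]

theorem ell1_le_of_forall_le {v : Fin m → ℝ} {c : ℝ} (h : ∀ i, |v i| ≤ c) : ell1 v ≤ m * c := by
  simpa [ell1] using Finset.sum_le_card_nsmul Finset.univ (fun i ↦ |v i|) c fun i _ ↦ h i

theorem ell1_eq_zero {v : Fin m → ℝ} : ell1 v = 0 ↔ v = 0 := by
  rw [ell1, Finset.sum_eq_zero_iff_of_nonneg fun _ _ ↦ abs_nonneg _]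
  simp [funext_iff]

theorem continuous_ell1 : Continuous (ell1 : (Fin m → ℝ) → ℝ) := by
  unfold ell1
  fun_prop

theorem isBounded_of_ell1_le {s : Set (Fin m → ℝ)} {R : ℝ} (h : ∀ v ∈ s, ell1 v ≤ R) :
    Bornology.IsBounded s := by
  refine isBounded_iff_forall_norm_le.2 ⟨|R|, fun v hv ↦ ?_⟩
  rw [pi_norm_le_iff_of_nonneg (abs_nonneg R)]
  exact fun i ↦ (abs_le_ell1 v i).trans ((h v hv).trans (le_abs_self R))

theorem isCompact_of_isClosed_of_ell1_le {s : Set (Fin m → ℝ)} {R : ℝ} (hs : IsClosed s)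
    (h : ∀ v ∈ s, ell1 v ≤ R) : IsCompact s :=
  Metric.isCompact_of_isClosed_isBounded hs (isBounded_of_ell1_le h)

/-- A `ℤ`-basis of a lattice, as a basis of `ℝ^m`. -/
def latticeBasis (L : UnimodularLattice m) : Module.Basis (Fin m) ℝ (Fin m → ℝ) :=
  (IsZLattice.basis L.carrier).ofZLatticeBasis ℝ L.carrier

theorem span_latticeBasis (L : UnimodularLattice m) :
    Submodule.span ℤ (Set.range (latticeBasis L)) = L.carrier :=
  Module.Basis.ofZLatticeBasis_span ℝ _ _

theorem finite_lattice_ball (L : UnimodularLattice m) (R : ℝ) :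
    {v | v ∈ L.carrier ∧ ell1 v ≤ R}.Finite := by
  have hb : Bornology.IsBounded {v : Fin m → ℝ | ell1 v ≤ R} := isBounded_of_ell1_le fun v hv ↦ hv
  refine (ZSpan.setFinite_inter (latticeBasis L) hb).subset ?_
  rintro v ⟨hv, hR⟩
  refine ⟨hR, ?_⟩
  rw [span_latticeBasis]
  exact hv

theorem eventually_abs_mulVec_sub_le {δ : ℝ} (hδ : 0 < δ) :
    ∀ᶠ k : SpecialLinearGroup (Fin m) ℝ in 𝓝 1, ∀ v i, |(k.1 *ᵥ v) i - v i| ≤ δ * ell1 v := by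
  have h : ∀ i j, ∀ᶠ k : SpecialLinearGroup (Fin m) ℝ in 𝓝 1,
      |k.1 i j - (1 : Matrix (Fin m) (Fin m) ℝ) i j| < δ := by
    intro i j
    have hc : Continuous fun k : SpecialLinearGroup (Fin m) ℝ ↦ k.1 i j :=
      (continuous_apply_apply i j).comp continuous_subtype_val
    have := Metric.tendsto_nhds.1 (hc.tendsto 1) δ hδ
    exact this
  have h' : ∀ᶠ k : SpecialLinearGroup (Fin m) ℝ in 𝓝 1, ∀ i j,
      |k.1 i j - (1 : Matrix (Fin m) (Fin m) ℝ) i j| < δ :=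
    eventually_all.2 fun i ↦ eventually_all.2 fun j ↦ h i j
  filter_upwards [h'] with k hk v i
  have h1 : (k.1 *ᵥ v) i - v i = ∑ j, (k.1 i j - (1 : Matrix (Fin m) (Fin m) ℝ) i j) * v j := by
    have h2 : v i = ((1 : Matrix (Fin m) (Fin m) ℝ) *ᵥ v) i := by rw [one_mulVec]
    conv_lhs => rw [h2]
    simp only [mulVec, dotProduct, sub_mul, Finset.sum_sub_distrib]
  rw [h1, ell1, Finset.mul_sum]
  refine (Finset.abs_sum_le_sum_abs _ _).trans (Finset.sum_le_sum fun j _ ↦ ?_)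
  rw [abs_mul]
  exact mul_le_mul_of_nonneg_right (hk i j).le (abs_nonneg _)

theorem eventually_ell1_mulVec_sub_le {δ : ℝ} (hδ : 0 < δ) :
    ∀ᶠ k : SpecialLinearGroup (Fin m) ℝ in 𝓝 1, ∀ v, ell1 (k.1 *ᵥ v - v) ≤ δ * ell1 v := by
  -- Dividing by `m + 1` instead of `m` avoids a separate case for dimension `0`.
  have hδ' : 0 < δ / (m + 1) := by positivity
  filter_upwards [eventually_abs_mulVec_sub_le hδ'] with k hk v
  refine (ell1_le_of_forall_le (hk v)).trans ?_
  rw [← mul_assoc]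
  refine mul_le_mul_of_nonneg_right ?_ (ell1_nonneg v)
  rw [mul_div_assoc', div_le_iff₀ (by positivity)]
  nlinarith

/-- If `0` is the only vector of `L` in the compact set `K`, then the same holds for all lattices
near `L`. -/
theorem eventually_forall_mem_act_eq_zero {L : UnimodularLattice m} {K : Set (Fin m → ℝ)}
    (hK : IsCompact K) (h : ∀ v ∈ L.carrier, v ∈ K → v = 0) :
    ∀ᶠ k : SpecialLinearGroup (Fin m) ℝ in 𝓝 1, ∀ v ∈ (act k L).carrier, v ∈ K → v = 0 := by
  obtain ⟨R, hR⟩ := (hK.image continuous_ell1).bddAbove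
  -- If `k` moves every vector by at most half its norm, only vectors of norm at most `2 * R` can
  -- land in `K`. These are finitely many in `L`, and each nonzero one stays in the open complement
  -- of `K`.
  have hS : ∀ᶠ k : SpecialLinearGroup (Fin m) ℝ in 𝓝 1,
      ∀ v ∈ {v | v ∈ L.carrier ∧ ell1 v ≤ 2 * R}, k.1 *ᵥ v ∈ K → v = 0 := by
    refine (eventually_all_finite (finite_lattice_ball L _)).2 fun v hv ↦ ?_
    by_cases h0 : v = 0
    · simp [h0]
    · have hvK : v ∈ Kᶜ := fun hvK ↦ h0 (h v hv.1 hvK)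
      filter_upwards [(tendsto_mulVec v).eventually (hK.isClosed.isOpen_compl.mem_nhds hvK)]
        with k hk hk'
      exact absurd hk' hk
  filter_upwards [hS, eventually_ell1_mulVec_sub_le (m := m) (δ := 1 / 2) (by norm_num)]
    with k hk1 hk2 u hu huK
  obtain ⟨v, rfl⟩ : ∃ v, k.1 *ᵥ v = u := ⟨_, mulVec_coe_inv_mulVec k u⟩
  rw [mulVec_mem_act] at hu
  have huR : ell1 (k.1 *ᵥ v) ≤ R := hR ⟨_, huK, rfl⟩
  have h1 := hk2 v
  have h2 : ell1 v ≤ ell1 (k.1 *ᵥ v) + ell1 (k.1 *ᵥ v - v) := by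
    have := ell1_add_le (k.1 *ᵥ v) (-(k.1 *ᵥ v - v))
    rw [ell1_neg] at this
    simpa using this
  have := hk1 v ⟨hu, by linarith⟩ huK
  rw [this, mulVec_zero]

/-- The lattices that contain a nonzero vector of norm at most `R` with `i`-th coordinate `0`. -/
def degenerate (R : ℝ) (i : Fin m) : Set (UnimodularLattice m) :=
  {L | ∃ v ∈ L.carrier, v ≠ 0 ∧ ell1 v ≤ R ∧ v i = 0}

theorem isClosed_degenerate (hm : 0 < m) (R : ℝ) (i : Fin m) :
    IsClosed (degenerate R i) := by
  rw [← isOpen_compl_iff, isOpen_iff_mem_nhds]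
  intro L hL
  have hK : IsCompact {v : Fin m → ℝ | ell1 v ≤ R ∧ v i = 0} := by
    refine isCompact_of_isClosed_of_ell1_le (R := R) ?_ fun v hv ↦ hv.1
    exact (isClosed_le continuous_ell1 continuous_const).inter
      (isClosed_eq (continuous_apply i) continuous_const)
  have hL' : ∀ v ∈ L.carrier, v ∈ {v : Fin m → ℝ | ell1 v ≤ R ∧ v i = 0} → v = 0 := by
    intro v hv hvK
    by_contra h0
    exact hL ⟨v, hv, h0, hvK⟩
  refine (eventually_nhds_iff hm).2 ?_
  filter_upwards [eventually_forall_mem_act_eq_zero hK hL'] with k hk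
  rintro ⟨v, hv, h0, hvK⟩
  exact h0 (hk v hv hvK)

/-- The shear whose `i`-th row is `(t^j / t^i)_j`. -/
def shear (i : Fin m) (t : ℝ) (ht : t ≠ 0) : SpecialLinearGroup (Fin m) ℝ :=
  ⟨(1 : Matrix (Fin m) (Fin m) ℝ).updateRow i fun j ↦ t ^ (j : ℕ) / t ^ (i : ℕ), by
    -- The new row is a combination of the rows of the identity, so the determinant is the
    -- coefficient of row `i`, which is `1`.
    have h : (fun j : Fin m ↦ t ^ (j : ℕ) / t ^ (i : ℕ)) =
        ∑ j : Fin m, (t ^ (j : ℕ) / t ^ (i : ℕ)) • (1 : Matrix (Fin m) (Fin m) ℝ) j := by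
      ext j
      simp [Finset.sum_apply, Matrix.one_apply]
    rw [h, det_updateRow_sum, det_one]
    simp [ht]⟩

/-- Up to a power of `t`, the `i`-th coordinate becomes a polynomial in `t` with coefficients `v`. A
nonzero vector therefore enters the hyperplane for finitely many `t` only. -/
theorem shear_mulVec_self (i : Fin m) {t : ℝ} (ht : t ≠ 0) (v : Fin m → ℝ) :
    ((shear i t ht).1 *ᵥ v) i = (∑ j, v j * t ^ (j : ℕ)) / t ^ (i : ℕ) := by
  simp only [shear, mulVec, dotProduct, updateRow_self, Finset.sum_div]
  exact Finset.sum_congr rfl fun j _ ↦ by ring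

theorem shear_mulVec_of_ne {i j : Fin m} (hij : j ≠ i) {t : ℝ} (ht : t ≠ 0) (v : Fin m → ℝ) :
    ((shear i t ht).1 *ᵥ v) j = v j := by
  have := congrFun (one_mulVec v) j
  simp only [mulVec, dotProduct] at this
  simpa only [shear, mulVec, dotProduct, updateRow_ne hij] using this

theorem finite_roots {v : Fin m → ℝ} (hv : v ≠ 0) :
    {t : ℝ | ∑ j, v j * t ^ (j : ℕ) = 0}.Finite := by
  let p : Polynomial ℝ := ∑ j : Fin m, Polynomial.monomial (j : ℕ) (v j)
  have hp : p ≠ 0 := by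
    obtain ⟨j, hj⟩ := Function.ne_iff.1 hv
    intro h
    apply hj
    have := congrArg (fun q ↦ q.coeff (j : ℕ)) h
    simpa [p, Polynomial.finsetSum_coeff, Polynomial.coeff_monomial, Fin.val_inj] using this
  refine (Polynomial.finite_setOfPred_isRoot hp).subset fun t ht ↦ ?_
  simpa [p, Polynomial.IsRoot, Polynomial.eval_finsetSum] using ht

/-- A lattice is degenerate after only finitely many of the shears. -/
theorem finite_shear_mem_degenerate (L : UnimodularLattice m) (R : ℝ) (i : Fin m) :
    {t : ℝ | ∃ h : 1 ≤ t, t ≤ 2 ∧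
      act (shear i t (by positivity)) L ∈ degenerate R i}.Finite := by
  -- The shear fixes all coordinates but the `i`-th, so these contribute at most `R`; the vanishing
  -- of the sheared `i`-th coordinate then bounds `|v i|` by `m * 2 ^ m * R`, uniformly in `t ∈ [1,
  -- 2]`. Hence finitely many vectors, each with finitely many roots, account for all `t`.
  have hfin : {v | v ∈ L.carrier ∧ ell1 v ≤ R + m * 2 ^ m * R ∧ v ≠ 0}.Finite :=
    (finite_lattice_ball L (R + m * 2 ^ m * R)).subset fun v hv ↦ ⟨hv.1, hv.2.1⟩
  refine (hfin.biUnion fun v hv ↦ finite_roots hv.2.2).subset ?_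
  rintro t ⟨ht1, ht2, u, hu, hu0, huR, hui⟩
  have ht0 : t ≠ 0 := by positivity
  obtain ⟨v, rfl⟩ : ∃ v, (shear i t ht0).1 *ᵥ v = u := ⟨_, mulVec_coe_inv_mulVec _ u⟩
  rw [mulVec_mem_act] at hu
  have hv0 : v ≠ 0 := by
    rintro rfl
    exact hu0 (mulVec_zero _)
  rw [shear_mulVec_self, div_eq_zero_iff, or_iff_left (pow_ne_zero _ ht0)] at hui
  refine Set.mem_biUnion (x := v) ⟨hu, ?_, hv0⟩ hui
  have hR0 : 0 ≤ R := (ell1_nonneg _).trans huR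
  have hvj : ∀ j ≠ i, |v j| ≤ R := by
    intro j hj
    rw [← shear_mulVec_of_ne hj ht0 v]
    exact (abs_le_ell1 _ j).trans huR
  have hpow : ∀ j : Fin m, t ^ (j : ℕ) ≤ 2 ^ m := fun j ↦
    (pow_le_pow_left₀ (by linarith) ht2 _).trans (pow_le_pow_right₀ (by norm_num) j.2.le)
  have hvi : |v i| ≤ m * (2 ^ m * R) := by
    -- The vanishing sum is solved for the `i`-th term; `1 ≤ t` allows its power of `t` to be
    -- dropped.
    have h1 : v i * t ^ (i : ℕ) = -∑ j ∈ Finset.univ.erase i, v j * t ^ (j : ℕ) := by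
      rw [← Finset.add_sum_erase _ _ (Finset.mem_univ i)] at hui
      linarith
    have h2 : |v i| ≤ |v i * t ^ (i : ℕ)| := by
      rw [abs_mul, abs_of_nonneg (by positivity : 0 ≤ t ^ (i : ℕ))]
      exact le_mul_of_one_le_right (abs_nonneg _) (one_le_pow₀ ht1)
    refine h2.trans ?_
    rw [h1, abs_neg]
    refine (Finset.abs_sum_le_sum_abs _ _).trans ?_
    refine (Finset.sum_le_card_nsmul _ _ (2 ^ m * R) fun j hj ↦ ?_).trans ?_
    · rw [abs_mul, abs_of_nonneg (by positivity : 0 ≤ t ^ (j : ℕ)), mul_comm]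
      exact mul_le_mul (hpow j) (hvj j (Finset.ne_of_mem_erase hj)) (abs_nonneg _) (by positivity)
    · rw [nsmul_eq_mul]
      refine mul_le_mul_of_nonneg_right ?_ (by positivity)
      have := (Finset.card_erase_le (s := Finset.univ) (a := i))
      rw [Finset.card_univ, Fintype.card_fin] at this
      exact_mod_cast this
  have h3 : ell1 v = |v i| + ∑ j ∈ Finset.univ.erase i, |v j| :=
    (Finset.add_sum_erase _ _ (Finset.mem_univ i)).symm
  have h4 : ell1 ((shear i t ht0).1 *ᵥ v) ≥ ∑ j ∈ Finset.univ.erase i, |v j| := by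
    rw [ell1, ← Finset.add_sum_erase _ _ (Finset.mem_univ i)]
    refine le_add_of_nonneg_of_le (abs_nonneg _) (Finset.sum_le_sum fun j hj ↦ ?_)
    rw [shear_mulVec_of_ne (Finset.ne_of_mem_erase hj)]
  rw [h3, mul_assoc]
  linarith

/-- The preimages of the degenerate set under infinitely many shears all have its measure, by
invariance. Each lattice lies in only finitely many of them, so their limit superior is empty; its
measure would be at least the common value, which must be `0`. -/
theorem measure_degenerate (hm : 0 < m) {mX : Measure (UnimodularLattice m)}
    [IsProbabilityMeasure mX] (hmX : ∀ g : SpecialLinearGroup (Fin m) ℝ, mX.map (act g) = mX)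
    (R : ℝ) (i : Fin m) : mX (degenerate R i) = 0 := by
  have hD := (isClosed_degenerate hm R i).measurableSet
  let t : ℕ → ℝ := fun n ↦ 1 + 1 / (n + 1)
  have ht1 : ∀ n, 1 ≤ t n := fun n ↦ by
    simp only [t]
    linarith [Nat.one_div_pos_of_nat (α := ℝ) (n := n)]
  have ht2 : ∀ n, t n ≤ 2 := fun n ↦ by
    have : 1 / ((n : ℝ) + 1) ≤ 1 := by
      rw [div_le_one (by positivity)]
      linarith [Nat.cast_nonneg (α := ℝ) n]
    simp only [t]
    linarith
  have htinj : Function.Injective t := by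
    intro a b h
    simp only [t, add_right_inj, one_div, _root_.inv_inj, add_left_inj, Nat.cast_inj] at h
    exact h
  let A : ℕ → Set (UnimodularLattice m) := fun n ↦
    act (shear i (t n) (by have := ht1 n; positivity)) ⁻¹' degenerate R i
  have hA : ∀ n, mX (A n) = mX (degenerate R i) := fun n ↦ by
    rw [← Measure.map_apply (continuous_act _).measurable hD, hmX]
  have hAm : ∀ n, MeasurableSet (A n) := fun n ↦ (continuous_act _).measurable hD
  let B : ℕ → Set (UnimodularLattice m) := fun n ↦ ⋃ k ≥ n, A k
  have hB : Antitone B := fun a b h ↦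
    Set.biUnion_mono (fun k hk ↦ le_trans h hk) fun _ _ ↦ subset_rfl
  have hBe : ⋂ n, B n = ∅ := by
    rw [Set.eq_empty_iff_forall_notMem]
    intro L hL
    have hfin : {n | L ∈ A n}.Finite := by
      refine ((finite_shear_mem_degenerate L R i).preimage htinj.injOn).subset fun n hn ↦ ?_
      exact ⟨ht1 n, ht2 n, hn⟩
    obtain ⟨N, hN⟩ := hfin.bddAbove
    obtain ⟨k, hk, hLk⟩ : ∃ k ≥ N + 1, L ∈ A k := by
      simpa [B] using Set.mem_iInter.1 hL (N + 1)
    have := hN hLk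
    omega
  have hlim : Tendsto (fun n ↦ mX (B n)) atTop (𝓝 0) := by
    have := tendsto_measure_iInter_atTop (μ := mX) (s := B)
      (fun n ↦ (MeasurableSet.biUnion (Set.to_countable _) fun k _ ↦ hAm k).nullMeasurableSet)
      hB ⟨0, measure_ne_top _ _⟩
    rwa [hBe, measure_empty] at this
  refine le_antisymm (ge_of_tendsto' hlim fun n ↦ ?_) zero_le
  rw [← hA n]
  exact measure_mono (Set.subset_biUnion_of_mem (u := A) (le_refl n))

end Degenerate

/-! ### The index tends to infinity -/

section Index

variable {m : ℕ}

theorem exists_isCompact_subset_measureReal_ge (hm : 0 < m) (mX : Measure (UnimodularLattice m))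
    [IsProbabilityMeasure mX] {U : Set (UnimodularLattice m)} (hU : IsOpen U) {ε : ℝ}
    (hε : 0 < ε) : ∃ K ⊆ U, IsCompact K ∧ mX.real U - ε ≤ mX.real K := by
  obtain ⟨K, hK, hmono, hKU⟩ := exists_isCompact_iUnion_eq hm hU
  have h1 : Tendsto (fun n ↦ mX.real (K n)) atTop (𝓝 (mX.real U)) := by
    rw [← hKU]
    exact (ENNReal.tendsto_toReal (measure_ne_top _ _)).comp
      (tendsto_measure_iUnion_atTop hmono)
  obtain ⟨n, hn⟩ := ((tendsto_order.1 h1).1 (mX.real U - ε) (by linarith)).exists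
  exact ⟨K n, hKU ▸ Set.subset_iUnion K n, hK n, hn.le⟩

theorem scale_le_one (m : ℕ) (ℓ : ℕ+) : scale m ℓ ≤ 1 :=
  Real.rpow_le_one_of_one_le_of_nonpos (Nat.one_le_cast.2 ℓ.pos)
    (by simp)

theorem mem_rescale {ℓ : ℕ+} {Λ : IndexSubgroup m ℓ} {v : Fin m → ℝ} :
    v ∈ (rescale Λ).carrier ↔ ∃ k ∈ Λ.1, scaleHom m ℓ k = v :=
  Iff.rfl

/-- The index annihilates the quotient, so `Λ` contains `ℓ e_j`, which lies in the `i`-th coordinate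
hyperplane and has norm at most `ℓ` after rescaling. -/
theorem rescale_mem_degenerate {ℓ : ℕ+} (Λ : IndexSubgroup m ℓ) {R : ℝ} (hR : (ℓ : ℝ) ≤ R)
    {i j : Fin m} (hij : j ≠ i) : rescale Λ ∈ degenerate R i := by
  have h0 : (ℓ : ℕ) • (Pi.single j 1 : Fin m → ℤ) ∈ Λ.1 := by
    have := Λ.1.nsmul_index_mem (Pi.single j 1)
    rwa [Λ.2] at this
  have hv : scaleHom m ℓ ((ℓ : ℕ) • (Pi.single j 1 : Fin m → ℤ)) =
      Pi.single j (scale m ℓ * ℓ) := by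
    ext a
    by_cases h : a = j
    · subst h
      simp [scaleHom]
    · simp [scaleHom, h]
  have hℓ : (0 : ℝ) < ℓ := by exact_mod_cast ℓ.pos
  have hpos : 0 < scale m ℓ * ℓ := mul_pos (scale_pos m ℓ) hℓ
  refine ⟨_, mem_rescale.2 ⟨_, h0, rfl⟩, ?_, ?_, ?_⟩
  · rw [hv]
    exact fun h ↦ hpos.ne' (Pi.single_eq_zero_iff.1 h)
  · rw [hv, ell1, Finset.sum_eq_single j]
    · rw [Pi.single_eq_same, abs_of_pos hpos]
      exact (mul_le_of_le_one_left hℓ.le (scale_le_one m ℓ)).trans hR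
    · intro a _ ha
      simp [ha]
    · simp
  · rw [hv]
    simp [hij.symm]

/-- A bump function supported off the closed null set `degenerate R i₀` has positive limit integral.
A family of index less than `R` lies inside that set, where the bump vanishes, so this cannot happen
for large `i`. The bound `2 ≤ m` provides a coordinate vector inside the hyperplane. -/
theorem tendsto_scale (hm : 2 ≤ m) {mX : Measure (UnimodularLattice m)} [IsProbabilityMeasure mX]
    (hmX : ∀ g : SpecialLinearGroup (Fin m) ℝ, mX.map (act g) = mX)
    {ℓ : ℕ → ℕ+} {𝒜 : (i : ℕ) → Finset (IndexSubgroup m (ℓ i))} (h𝒜 : ∀ i, (𝒜 i).Nonempty)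
    (hconv : WeakStarTendsto (fun i ↦ familyMeasure (𝒜 i) (h𝒜 i)) mX) :
    Tendsto (fun i ↦ scale m (ℓ i)) atTop (𝓝 0) := by
  have hm0 : 0 < m := by omega
  have := t2Space_unimodularLattice hm0
  have := locallyCompactSpace_unimodularLattice hm0
  have hℓ : Tendsto (fun i ↦ ((ℓ i : ℕ) : ℝ)) atTop atTop := by
    refine tendsto_atTop.2 fun R ↦ ?_
    let i₀ : Fin m := ⟨0, by omega⟩
    let j₀ : Fin m := ⟨1, by omega⟩
    have hij : j₀ ≠ i₀ := by simp [i₀, j₀]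
    have hU : IsOpen (degenerate R i₀)ᶜ := (isClosed_degenerate hm0 R i₀).isOpen_compl
    have hμU : mX.real (degenerate R i₀)ᶜ = 1 := by
      rw [probReal_compl_eq_one_sub (isClosed_degenerate hm0 R i₀).measurableSet, measureReal_def,
        measure_degenerate hm0 hmX]
      simp
    obtain ⟨K, hKU, hK, hμK⟩ :=
      exists_isCompact_subset_measureReal_ge hm0 mX hU (ε := 1 / 2) (by norm_num)
    obtain ⟨φ, hφK, hφc, hφU, hφ⟩ := exists_continuousMap_one_of_isCompact_subset_isOpen hK hU hKU
    have hφμ : 1 / 2 ≤ ∫ x, φ x ∂mX := by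
      refine le_trans (by linarith) (hμK.trans ?_)
      rw [← integral_indicator_one hK.measurableSet]
      refine integral_mono ((integrable_const (1 : ℝ)).indicator hK.measurableSet)
        (φ.continuous.integrable_of_hasCompactSupport hφc) fun x ↦ ?_
      by_cases hx : x ∈ K
      · simp [hx, hφK hx]
      · simpa [hx] using (hφ x).1
    have h1 := (tendsto_order.1 (hconv φ φ.continuous hφc)).1 0 (by linarith)
    filter_upwards [h1] with i hi
    by_contra! hlt
    refine hi.ne' (integral_eq_zero_of_ae ?_)
    filter_upwards [ae_mem_normalizedCounting (rescaledFamily_nonempty (h𝒜 i))] with x hx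
    obtain ⟨Λ, -, rfl⟩ := Finset.mem_map.1 hx
    refine image_eq_zero_of_notMem_tsupport fun h ↦ hφU h ?_
    exact rescale_mem_degenerate Λ hlt.le hij
  have hexp : 0 < 1 / (m : ℝ) := by positivity
  exact (tendsto_rpow_neg_atTop hexp).comp hℓ

end Index

/-! ### Coverings of space by translates of the ball -/

section Covering

variable {m : ℕ}

/-- The cone over the ball. -/
def cone (m : ℕ) : Sense → Set (Fin m → ℝ)
  | .undirected => Set.univ
  | .directed => {v | ∀ i, 0 < v i}

theorem mem_smul_ball {σ : Sense} {t : ℝ} (ht : 0 < t) {v : Fin m → ℝ} :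
    v ∈ t • ball m σ ↔ v ∈ cone m σ ∧ ell1 v < t := by
  rw [Set.mem_smul_set_iff_inv_smul_mem₀ ht.ne']
  have h1 : ell1 (t⁻¹ • v) < 1 ↔ ell1 v < t := by
    rw [ell1_smul, abs_of_pos (inv_pos.2 ht), inv_mul_lt_one₀ ht]
  cases σ with
  | undirected =>
    rw [← h1]
    exact (and_iff_right (Set.mem_univ _)).symm
  | directed =>
    have h2 : (∀ i, 0 < (t⁻¹ • v) i) ↔ ∀ i, 0 < v i := forall_congr' fun i ↦ by
      simp [ht]
    change (∀ i, 0 < (t⁻¹ • v) i) ∧ ∑ i, (t⁻¹ • v) i < 1 ↔ (∀ i, 0 < v i) ∧ _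
    rw [h2]
    refine and_congr_right fun hv ↦ ?_
    rw [← h1, ell1, Finset.sum_congr rfl fun i _ ↦ abs_of_pos (h2.2 hv i)]

/-- Every translate of `L` meets the ball of radius `t`. -/
def Covers (L : Submodule ℤ (Fin m → ℝ)) (σ : Sense) (t : ℝ) : Prop :=
  ∀ z, ∃ v ∈ L, z + v ∈ cone m σ ∧ ell1 (z + v) < t

theorem add_smul_ball_eq_univ_iff {L : Submodule ℤ (Fin m → ℝ)} {σ : Sense} {t : ℝ} (ht : 0 < t) :
    (L : Set (Fin m → ℝ)) + t • ball m σ = Set.univ ↔ Covers L σ t := by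
  rw [Set.eq_univ_iff_forall]
  refine forall_congr' fun z ↦ ?_
  rw [Set.mem_add]
  constructor
  · rintro ⟨v, hv, w, hw, rfl⟩
    refine ⟨-v, neg_mem hv, ?_⟩
    rw [mem_smul_ball ht] at hw
    simpa using hw
  · rintro ⟨v, hv, h⟩
    exact ⟨-v, neg_mem hv, z + v, (mem_smul_ball ht).2 h, by abel⟩

theorem Covers.mono {L : Submodule ℤ (Fin m → ℝ)} {σ : Sense} {t t' : ℝ} (h : Covers L σ t)
    (htt' : t ≤ t') : Covers L σ t' := fun z ↦
  let ⟨v, hv, hz, hlt⟩ := h z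
  ⟨v, hv, hz, hlt.trans_le htt'⟩

theorem Covers.pos {L : Submodule ℤ (Fin m → ℝ)} {σ : Sense} {t : ℝ} (h : Covers L σ t) :
    0 < t :=
  let ⟨_, _, _, hlt⟩ := h 0
  (ell1_nonneg _).trans_lt hlt

theorem onUnimodular_diameter (L : UnimodularLattice m) (σ : Sense) :
    (Parameter.diameter σ).onUnimodular L = sInf {t | Covers L.carrier σ t} := by
  change sInf {t : ℝ | 0 < t ∧ (L.carrier : Set (Fin m → ℝ)) + t • ball m σ = Set.univ} = _
  congr 1
  ext t
  constructor
  · rintro ⟨ht, h⟩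
    exact (add_smul_ball_eq_univ_iff ht).1 h
  · intro h
    exact ⟨h.pos, (add_smul_ball_eq_univ_iff h.pos).2 h⟩

theorem exists_covers (L : UnimodularLattice m) (σ : Sense) : ∃ t, Covers L.carrier σ t := by
  let b := latticeBasis L
  let C : ℝ := ∑ i, ‖b i‖
  have hC : 0 ≤ C := Finset.sum_nonneg fun _ _ ↦ norm_nonneg _
  -- Reducing `z - (C + 1, …, C + 1)` modulo `L` leaves coordinates in `[-C, C]`; adding the shift
  -- back puts them in `[1, 2 * C + 1]`, inside the open orthant.
  refine ⟨m * (2 * C + 1) + 1, fun z ↦ ?_⟩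
  let w : Fin m → ℝ := z - fun _ ↦ (C + 1)
  let u := ZSpan.fract b w
  have hu : ∀ i, |u i| ≤ C := fun i ↦
    (norm_le_pi_norm u i).trans (ZSpan.norm_fract_le b w)
  have hv : -(ZSpan.floor b w : Fin m → ℝ) ∈ L.carrier := by
    rw [← span_latticeBasis L]
    exact neg_mem (ZSpan.floor b w).2
  have hz : z + -(ZSpan.floor b w : Fin m → ℝ) = u + fun _ ↦ (C + 1) := by
    simp only [u, ZSpan.fract_apply, w]
    abel
  refine ⟨_, hv, ?_, ?_⟩
  · rw [hz]
    cases σ with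
    | undirected => exact Set.mem_univ _
    | directed =>
      intro i
      have := (abs_le.1 (hu i)).1
      simp only [Pi.add_apply]
      linarith
  · rw [hz]
    refine lt_of_le_of_lt (ell1_le_of_forall_le (c := 2 * C + 1) fun i ↦ ?_) (lt_add_one _)
    have := abs_le.1 (hu i)
    simp only [Pi.add_apply]
    rw [abs_of_nonneg] <;> linarith

theorem exists_pos_le_ell1 (L : UnimodularLattice m) :
    ∃ r > 0, ∀ v ∈ L.carrier, v ≠ 0 → r ≤ ell1 v := by
  have h : ∀ᶠ r : ℝ in 𝓝[>] 0, ∀ v ∈ {v | v ∈ L.carrier ∧ ell1 v ≤ 1}, v ≠ 0 → r ≤ ell1 v := by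
    refine (eventually_all_finite (finite_lattice_ball L 1)).2 fun v _ ↦ ?_
    by_cases hv : v = 0
    · simp [hv]
    · have hpos : 0 < ell1 v := lt_of_le_of_ne (ell1_nonneg v) fun h ↦ hv (ell1_eq_zero.1 h.symm)
      filter_upwards [eventually_nhdsWithin_of_eventually_nhds (eventually_le_nhds hpos)]
        with r hr _ using hr
  obtain ⟨r, hr, hr0, hr1⟩ := (h.and ((eventually_mem_nhdsWithin).and
    (eventually_nhdsWithin_of_eventually_nhds (eventually_le_nhds zero_lt_one)))).exists
  refine ⟨r, hr0, fun v hv hv0 ↦ ?_⟩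
  by_cases h1 : ell1 v ≤ 1
  · exact hr v ⟨hv, h1⟩ hv0
  · linarith

/-- A point within half the minimal length `r` of the origin has no lattice translate nearer to the
origin. This is the source of the positive lower bounds for the covering radius and the moments. -/
theorem le_ell1_add_of_mem {L : UnimodularLattice m} {r : ℝ}
    (hr : ∀ v ∈ L.carrier, v ≠ 0 → r ≤ ell1 v) {z : Fin m → ℝ} (hz : ell1 z ≤ r / 2)
    {v : Fin m → ℝ} (hv : v ∈ L.carrier) : ell1 z ≤ ell1 (z + v) := by
  by_cases h : v = 0
  · simp [h]
  · have h1 := ell1_add_le (z + v) (-z)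
    rw [ell1_neg, add_neg_cancel_comm] at h1
    linarith [hr v hv h]

theorem ell1_single (i : Fin m) (c : ℝ) : ell1 (Pi.single i c) = |c| := by
  rw [ell1, Finset.sum_eq_single i] <;> simp +contextual

theorem onUnimodular_diameter_pos (hm : 0 < m) (L : UnimodularLattice m) (σ : Sense) :
    0 < (Parameter.diameter σ).onUnimodular L := by
  rw [onUnimodular_diameter]
  obtain ⟨r, hr0, hr⟩ := exists_pos_le_ell1 L
  refine lt_of_lt_of_le (half_pos hr0) (le_csInf (exists_covers L σ) fun t ht ↦ ?_)
  have hz : ell1 (Pi.single (⟨0, hm⟩ : Fin m) (r / 2)) = r / 2 := by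
    rw [ell1_single, abs_of_pos (half_pos hr0)]
  obtain ⟨v, hv, -, hlt⟩ := ht (Pi.single (⟨0, hm⟩ : Fin m) (r / 2))
  have := le_ell1_add_of_mem hr hz.le hv
  linarith

theorem bddBelow_covers (L : Submodule ℤ (Fin m → ℝ)) (σ : Sense) : BddBelow {t | Covers L σ t} :=
  ⟨0, fun _ h ↦ h.pos.le⟩

theorem covers_of_onUnimodular_diameter_lt {L : UnimodularLattice m} {σ : Sense} {t : ℝ}
    (h : (Parameter.diameter σ).onUnimodular L < t) : Covers L.carrier σ t := by
  rw [onUnimodular_diameter] at h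
  obtain ⟨t', ht', hlt⟩ := exists_lt_of_csInf_lt (exists_covers L σ) h
  exact Covers.mono ht' hlt.le

theorem onUnimodular_diameter_le {L : UnimodularLattice m} {σ : Sense} {t : ℝ}
    (h : Covers L.carrier σ t) : (Parameter.diameter σ).onUnimodular L ≤ t := by
  rw [onUnimodular_diameter]
  exact csInf_le (bddBelow_covers _ σ) h

/-- A matrix near the identity followed by a small translation maps a ball into a slightly larger
one. -/
theorem mulVec_add_mem_cone {k : SpecialLinearGroup (Fin m) ℝ} {δ : ℝ} (hδ : 0 < δ)
    (hk : ∀ v i, |(k.1 *ᵥ v) i - v i| ≤ δ * ell1 v) {σ : Sense} {v : Fin m → ℝ}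
    (hv : v ∈ cone m σ) {T : ℝ} (hT : ell1 v ≤ T) :
    (k.1 *ᵥ v + fun _ ↦ T * δ) ∈ cone m σ ∧
      ell1 (k.1 *ᵥ v + fun _ ↦ T * δ) ≤ ell1 v + 2 * m * δ * T := by
  have hT0 : 0 ≤ T := (ell1_nonneg v).trans hT
  have hδT : δ * ell1 v ≤ T * δ := by
    rw [mul_comm T]
    exact mul_le_mul_of_nonneg_left hT hδ.le
  constructor
  · cases σ with
    | undirected => exact Set.mem_univ _
    | directed =>
      intro i
      -- The matrix can lower a coordinate by at most `δ * ell1 v ≤ T * δ`; the translation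
      -- compensates for this and keeps the vector in the open orthant.
      have h1 := (abs_le.1 (hk v i)).1
      have h2 : 0 < v i := hv i
      simp only [Pi.add_apply]
      linarith
  · have h1 : ell1 ((k.1 *ᵥ v - v) + fun _ ↦ T * δ) ≤ m * (2 * (T * δ)) := by
      refine ell1_le_of_forall_le fun i ↦ ?_
      refine (abs_add_le _ _).trans ?_
      have h2 := hk v i
      rw [abs_of_nonneg (by positivity : 0 ≤ T * δ)]
      simp only [Pi.sub_apply]
      linarith
    have h2 := ell1_add_le v ((k.1 *ᵥ v - v) + fun _ ↦ T * δ)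
    have h3 : v + ((k.1 *ᵥ v - v) + fun _ ↦ T * δ) = k.1 *ᵥ v + fun _ ↦ T * δ := by abel
    rw [h3] at h2
    linarith

/-- Covering is a condition on all translates of the lattice, so the auxiliary translation can be
absorbed by starting from `k⁻¹ (z - t δ (1, …, 1))`. -/
theorem Covers.act {k : SpecialLinearGroup (Fin m) ℝ} {δ : ℝ} (hδ : 0 < δ)
    (hk : ∀ v i, |(k.1 *ᵥ v) i - v i| ≤ δ * ell1 v) {L : UnimodularLattice m} {σ : Sense} {t : ℝ}
    (h : Covers L.carrier σ t) : Covers (act k L).carrier σ (t + 2 * m * δ * t) := by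
  intro z
  obtain ⟨v, hv, hc, hlt⟩ := h ((k⁻¹).1 *ᵥ (z - fun _ ↦ t * δ))
  have := mulVec_add_mem_cone hδ hk hc hlt.le
  have hz : (k.1 *ᵥ ((k⁻¹).1 *ᵥ (z - fun _ ↦ t * δ) + v) + fun _ ↦ t * δ) = z + k.1 *ᵥ v := by
    rw [mulVec_add, mulVec_coe_inv_mulVec]
    abel
  rw [hz] at this
  exact ⟨_, mulVec_mem_act.2 hv, this.1, by linarith [this.2]⟩

/-- A function on `X_m` is continuous if it increases only slightly under the action of elements
near `1`, uniformly where a locally bounded function `g` is bounded. -/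
theorem continuous_of_eventually_act_le (hm : 0 < m) {f g : UnimodularLattice m → ℝ}
    (hg : ∀ L, ∀ᶠ k : SpecialLinearGroup (Fin m) ℝ in 𝓝 1, g (act k L) ≤ g L + 1)
    (h : ∀ T, ∀ ε > 0, ∀ᶠ k : SpecialLinearGroup (Fin m) ℝ in 𝓝 1, ∀ L, g L ≤ T →
      f (act k L) ≤ f L + ε) : Continuous f := by
  rw [continuous_iff_continuousAt]
  intro L
  refine Metric.tendsto_nhds.2 fun ε hε ↦ (eventually_nhds_iff hm).2 ?_
  have h1 := h (g L + 1) (ε / 2) (by positivity)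
  have hinv : Tendsto (fun k : SpecialLinearGroup (Fin m) ℝ ↦ k⁻¹) (𝓝 1) (𝓝 1) := by
    simpa using (continuous_inv (G := SpecialLinearGroup (Fin m) ℝ)).tendsto 1
  filter_upwards [h1, hinv.eventually h1, hg L] with k hk1 hk2 hk3
  have e1 := hk1 L (by linarith)
  -- The reverse inequality is the same estimate for `k⁻¹` at `act k L`, where `g` may have grown by
  -- `1`.
  have e2 := hk2 (act k L) hk3
  rw [act_inv_act] at e2
  rw [Real.dist_eq, abs_lt]
  constructor <;> linarith

theorem eventually_onUnimodular_diameter_act_le (hm : 0 < m) (σ : Sense) (T : ℝ) {ε : ℝ}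
    (hε : 0 < ε) : ∀ᶠ k : SpecialLinearGroup (Fin m) ℝ in 𝓝 1, ∀ L,
      (Parameter.diameter σ).onUnimodular L ≤ T →
        (Parameter.diameter σ).onUnimodular (act k L) ≤
          (Parameter.diameter σ).onUnimodular L + ε := by
  have hT : 0 < 2 * m * (|T| + 1) := by positivity
  filter_upwards [eventually_abs_mulVec_sub_le (m := m) (δ := ε / (2 * m * (|T| + 1)))
    (by positivity)] with k hk L hL
  set d := (Parameter.diameter σ).onUnimodular L
  have hc : 2 * m * (ε / (2 * m * (|T| + 1))) * d ≤ ε := by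
    have hd : d ≤ |T| + 1 := by linarith [le_abs_self T]
    calc 2 * m * (ε / (2 * m * (|T| + 1))) * d
        ≤ 2 * m * (ε / (2 * m * (|T| + 1))) * (|T| + 1) :=
          mul_le_mul_of_nonneg_left hd (by positivity)
      _ = ε := by field_simp
  -- The lattice need not cover at the infimum `d` itself, so the bound is obtained for `t > d` and
  -- passed to the limit.
  have hlim : Tendsto (fun t : ℝ ↦ t + 2 * m * (ε / (2 * m * (|T| + 1))) * t) (𝓝[>] d)
      (𝓝 (d + 2 * m * (ε / (2 * m * (|T| + 1))) * d)) :=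
    (Continuous.tendsto (by fun_prop) d).mono_left nhdsWithin_le_nhds
  refine le_trans (ge_of_tendsto hlim ?_) (add_le_add_right hc d)
  filter_upwards [self_mem_nhdsWithin] with t ht
  exact onUnimodular_diameter_le
    (Covers.act (by positivity) hk (covers_of_onUnimodular_diameter_lt ht))

theorem continuous_onUnimodular_diameter (hm : 0 < m) (σ : Sense) :
    Continuous ((Parameter.diameter σ).onUnimodular : UnimodularLattice m → ℝ) :=
  continuous_of_eventually_act_le hm
    (fun L ↦ (eventually_onUnimodular_diameter_act_le hm σ _ one_pos).mono fun _ hk ↦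
      hk L le_rfl)
    fun T _ hε ↦ eventually_onUnimodular_diameter_act_le hm σ T hε

end Covering

/-! ### Moments of the distance in a torus -/

section Moment

variable {m : ℕ}

theorem spaceDist_eq_of_mem {σ : Sense} {x y : Fin m → ℝ} (h : y - x ∈ cone m σ) :
    spaceDist σ x y = ENNReal.ofReal (ell1 (y - x)) := by
  have hiff : ∀ t : ℝ, 0 < t → (y ∈ x +ᵥ t • ball m σ ↔ ell1 (y - x) < t) := by
    intro t ht
    rw [Set.mem_vadd_set_iff_neg_vadd_mem, vadd_eq_add, neg_add_eq_sub, mem_smul_ball ht,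
      and_iff_right h]
  refine le_antisymm ?_ (le_iInf₂ fun t ht ↦ ENNReal.ofReal_le_ofReal ((hiff t ht.1).1 ht.2).le)
  have hlim : Tendsto ENNReal.ofReal (𝓝[>] (ell1 (y - x))) (𝓝 (ENNReal.ofReal (ell1 (y - x)))) :=
    (ENNReal.continuous_ofReal.tendsto _).mono_left nhdsWithin_le_nhds
  refine ge_of_tendsto hlim ?_
  filter_upwards [self_mem_nhdsWithin] with t ht
  have ht0 : 0 < t := (ell1_nonneg _).trans_lt ht
  exact iInf₂_le t ⟨ht0, (hiff t ht0).2 ht⟩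

theorem spaceDist_eq_top {σ : Sense} {x y : Fin m → ℝ} (h : y - x ∉ cone m σ) :
    spaceDist σ x y = ⊤ := by
  refine iInf₂_eq_top.2 fun t ht ↦ absurd ?_ h
  have := ht.2
  rw [Set.mem_vadd_set_iff_neg_vadd_mem, vadd_eq_add, neg_add_eq_sub, mem_smul_ball ht.1] at this
  exact this.1

/-- The distance from `0` to `z` in the torus is attained at some translate of `z`. -/
theorem exists_isLeast_ell1_add (L : UnimodularLattice m) (σ : Sense) (z : Fin m → ℝ) :
    ∃ v ∈ L.carrier, z + v ∈ cone m σ ∧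
      ∀ w ∈ L.carrier, z + w ∈ cone m σ → ell1 (z + v) ≤ ell1 (z + w) := by
  obtain ⟨t, ht⟩ := exists_covers L σ
  obtain ⟨v₀, hv₀, hc₀, -⟩ := ht z
  have hfin : {v | v ∈ L.carrier ∧ z + v ∈ cone m σ ∧ ell1 (z + v) ≤ ell1 (z + v₀)}.Finite := by
    refine (finite_lattice_ball L (ell1 (z + v₀) + ell1 z)).subset fun v hv ↦ ⟨hv.1, ?_⟩
    have := ell1_add_le (z + v) (-z)
    rw [ell1_neg, add_neg_cancel_comm] at this
    linarith [hv.2.2]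
  obtain ⟨v, hv, hmin⟩ := Set.exists_min_image _ (fun v ↦ ell1 (z + v)) hfin
    ⟨v₀, hv₀, hc₀, le_rfl⟩
  refine ⟨v, hv.1, hv.2.1, fun w hw hcw ↦ ?_⟩
  by_cases h : ell1 (z + w) ≤ ell1 (z + v₀)
  · exact hmin w ⟨hw, hcw, h⟩
  · exact hv.2.2.trans (not_le.1 h).le

/-- The distance from `0` to `z` in the torus. -/
def cost (L : UnimodularLattice m) (σ : Sense) (z : Fin m → ℝ) : ℝ :=
  ell1 (z + (exists_isLeast_ell1_add L σ z).choose)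

theorem exists_cost_eq (L : UnimodularLattice m) (σ : Sense) (z : Fin m → ℝ) :
    ∃ v ∈ L.carrier, z + v ∈ cone m σ ∧ ell1 (z + v) = cost L σ z :=
  ⟨_, (exists_isLeast_ell1_add L σ z).choose_spec.1,
    (exists_isLeast_ell1_add L σ z).choose_spec.2.1, rfl⟩

theorem cost_le {L : UnimodularLattice m} {σ : Sense} {z v : Fin m → ℝ} (hv : v ∈ L.carrier)
    (hc : z + v ∈ cone m σ) : cost L σ z ≤ ell1 (z + v) :=
  (exists_isLeast_ell1_add L σ z).choose_spec.2.2 v hv hc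

theorem cost_nonneg (L : UnimodularLattice m) (σ : Sense) (z : Fin m → ℝ) : 0 ≤ cost L σ z :=
  ell1_nonneg _

theorem cost_add_le {L : UnimodularLattice m} {σ : Sense} {v : Fin m → ℝ} (hv : v ∈ L.carrier)
    (z : Fin m → ℝ) : cost L σ (v + z) ≤ cost L σ z := by
  obtain ⟨w, hw, hc, h⟩ := exists_cost_eq L σ z
  have h1 : v + z + (w - v) = z + w := by abel
  rw [← h, ← h1]
  exact cost_le (sub_mem hw hv) (h1 ▸ hc)

theorem cost_add {L : UnimodularLattice m} {σ : Sense} {v : Fin m → ℝ} (hv : v ∈ L.carrier)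
    (z : Fin m → ℝ) : cost L σ (v + z) = cost L σ z := by
  refine le_antisymm (cost_add_le hv z) ?_
  have := cost_add_le (σ := σ) (neg_mem hv) (v + z)
  rwa [neg_add_cancel_left] at this

theorem cost_lt_of_covers {L : UnimodularLattice m} {σ : Sense} {t : ℝ}
    (h : Covers L.carrier σ t) (z : Fin m → ℝ) : cost L σ z < t :=
  let ⟨_, hv, hc, hlt⟩ := h z
  (cost_le hv hc).trans_lt hlt

theorem cost_le_diameter (L : UnimodularLattice m) (σ : Sense) (z : Fin m → ℝ) :
    cost L σ z ≤ (Parameter.diameter σ).onUnimodular L :=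
  le_of_forall_gt fun _ ht ↦ cost_lt_of_covers (covers_of_onUnimodular_diameter_lt ht) z

theorem torusDist_eq (L : UnimodularLattice m) (σ : Sense) (x y : Fin m → ℝ) :
    torusDist σ L.carrier x y = ENNReal.ofReal (cost L σ (y - x)) := by
  refine le_antisymm ?_ (le_iInf₂ fun v hv ↦ ?_)
  · obtain ⟨v, hv, hc, h⟩ := exists_cost_eq L σ (y - x)
    have h1 : y - x + v = y + v - x := by abel
    rw [← h, h1, ← spaceDist_eq_of_mem (h1 ▸ hc)]
    exact iInf₂_le v hv
  · have h1 : y - x + v = y + v - x := by abel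
    by_cases hc : y + v - x ∈ cone m σ
    · rw [spaceDist_eq_of_mem hc]
      exact ENNReal.ofReal_le_ofReal (h1 ▸ cost_le hv (h1 ▸ hc))
    · rw [spaceDist_eq_top hc]
      exact le_top

/-! ### Integrals of periodic functions over the torus. -/

theorem isAddFundamentalDomain_torusDomain (L : UnimodularLattice m) :
    IsAddFundamentalDomain L.carrier (torusDomain L.carrier) volume :=
  ZLattice.isAddFundamentalDomain _ _

theorem volume_torusDomain (L : UnimodularLattice m) : volume (torusDomain L.carrier) = 1 := by
  have h := L.covolume_eq_one
  rw [ZLattice.covolume_eq_measure_fundamentalDomain _ _ (isAddFundamentalDomain_torusDomain L),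
    measureReal_def] at h
  exact (ENNReal.toReal_eq_one_iff _).1 h

instance (L : Submodule ℤ (Fin m → ℝ)) : VAddInvariantMeasure L (Fin m → ℝ) volume :=
  ⟨fun v s _ ↦ measure_preimage_add volume (v : Fin m → ℝ) s⟩

theorem existsUnique_add_mem_torusDomain (L : UnimodularLattice m) (x : Fin m → ℝ) :
    ∃ v ∈ L.carrier, v + x ∈ torusDomain L.carrier ∧
      ∀ w ∈ L.carrier, w + x ∈ torusDomain L.carrier → w = v := by
  obtain ⟨v, hv, huniq⟩ := ZSpan.exist_unique_vadd_mem_fundamentalDomain (latticeBasis L) x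
  have hspan : ∀ w, w ∈ L.carrier ↔ w ∈ Submodule.span ℤ (Set.range (latticeBasis L)) := by
    intro w
    rw [span_latticeBasis]
  exact ⟨v, (hspan v).2 v.2, hv, fun w hw h ↦
    congrArg Subtype.val (huniq ⟨w, (hspan w).1 hw⟩ h)⟩

theorem measurePreserving_affine (k : SpecialLinearGroup (Fin m) ℝ) (c : Fin m → ℝ) :
    MeasurePreserving (fun z ↦ k.1 *ᵥ z + c) volume volume :=
  (measurePreserving_add_right volume c).comp (measurePreserving_specialLinear k)

theorem measurableEmbedding_affine (k : SpecialLinearGroup (Fin m) ℝ) (c : Fin m → ℝ) :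
    MeasurableEmbedding (fun z ↦ k.1 *ᵥ z + c) :=
  (measurableEmbedding_addRight c).comp
    (SpecialLinearGroup.toLin' k).toContinuousLinearEquiv.toHomeomorph.measurableEmbedding

/-- The integral of an `L`-periodic function over `ℝ^m / L` does not change under an affine change
of variables. -/
theorem setLIntegral_comp_affine (k : SpecialLinearGroup (Fin m) ℝ) (c : Fin m → ℝ)
    (L : UnimodularLattice m) {f : (Fin m → ℝ) → ℝ≥0∞}
    (hf : ∀ v ∈ (act k L).carrier, ∀ z, f (v + z) = f z) :
    ∫⁻ z in torusDomain L.carrier, f (k.1 *ᵥ z + c) =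
      ∫⁻ z in torusDomain (act k L).carrier, f z := by
  rw [(measurePreserving_affine k c).setLIntegral_comp_emb (measurableEmbedding_affine k c)]
  -- The affine image of a fundamental domain of `L` is one of `act k L`, and periodic functions
  -- have the same integral over any two.
  refine IsAddFundamentalDomain.setLIntegral_eq (G := (act k L).carrier) ?_
    (isAddFundamentalDomain_torusDomain _) f fun g x ↦ hf g g.2 x
  refine IsAddFundamentalDomain.mk' ?_ fun x ↦ ?_
  · exact ((measurableEmbedding_affine k c).measurableSet_image.2
      (ZSpan.fundamentalDomain_measurableSet _)).nullMeasurableSet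
  · obtain ⟨v, hv, hvD, huniq⟩ := existsUnique_add_mem_torusDomain L ((k⁻¹).1 *ᵥ (x - c))
    refine ⟨⟨k.1 *ᵥ v, mulVec_mem_act.2 hv⟩, ⟨_, hvD, ?_⟩, ?_⟩
    · simp only [mulVec_add, mulVec_coe_inv_mulVec, Submodule.vadd_def, vadd_eq_add]
      abel
    · rintro ⟨w, hw⟩ ⟨y, hy, hyw⟩
      simp only [Submodule.vadd_def, vadd_eq_add] at hyw
      have h1 : (k⁻¹).1 *ᵥ w + (k⁻¹).1 *ᵥ (x - c) = y := by
        rw [← mulVec_add, ← coe_inv_mulVec_mulVec k y, eq_sub_of_add_eq hyw]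
        congr 1
        abel
      have := huniq _ (mem_act.1 hw) (by rwa [h1])
      ext1
      change w = k.1 *ᵥ v
      rw [← this, mulVec_coe_inv_mulVec]

theorem setLIntegral_comp_add (L : UnimodularLattice m) {f : (Fin m → ℝ) → ℝ≥0∞}
    (hf : ∀ v ∈ L.carrier, ∀ z, f (v + z) = f z) (c : Fin m → ℝ) :
    ∫⁻ z in torusDomain L.carrier, f (z + c) = ∫⁻ z in torusDomain L.carrier, f z := by
  have := setLIntegral_comp_affine (f := f) 1 c L (by rwa [act_one])
  simp only [coe_one_mulVec] at this
  rw [this, act_one]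

/-- The mean value of the `α`-th power of the distance from `0` in the torus. -/
def meanCost (σ : Sense) (α : ℝ) (L : UnimodularLattice m) : ℝ :=
  (∫⁻ z in torusDomain L.carrier, ENNReal.ofReal (cost L σ z ^ α)).toReal

/-- The distance depends only on `y - x`, so the inner integral does not depend on `x` and the
double mean is a single one. -/
theorem onUnimodular_moment (σ : Sense) {α : ℝ} (hα : 0 < α) (L : UnimodularLattice m) :
    (Parameter.moment σ α hα).onUnimodular L = meanCost σ α L ^ (1 / α) := by
  change (((volume (torusDomain L.carrier) ^ 2)⁻¹ * ∫⁻ x in torusDomain L.carrier,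
    ∫⁻ y in torusDomain L.carrier, torusDist σ L.carrier x y ^ α).toReal) ^ (1 / α) = _
  have h : ∀ x, ∫⁻ y in torusDomain L.carrier, torusDist σ L.carrier x y ^ α =
      ∫⁻ z in torusDomain L.carrier, ENNReal.ofReal (cost L σ z ^ α) := by
    intro x
    rw [← setLIntegral_comp_add L (f := fun z ↦ ENNReal.ofReal (cost L σ z ^ α))
      (fun v hv z ↦ by rw [cost_add hv]) (-x)]
    refine lintegral_congr fun y ↦ ?_
    rw [torusDist_eq, ENNReal.ofReal_rpow_of_nonneg (cost_nonneg _ _ _) hα.le, sub_eq_add_neg]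
  simp only [h, lintegral_const, volume_torusDomain, Measure.restrict_apply_univ, meanCost]
  simp

theorem setLIntegral_ofReal_le {L : UnimodularLattice m} {f : (Fin m → ℝ) → ℝ} {C : ℝ}
    (h : ∀ z, f z ≤ C) :
    ∫⁻ z in torusDomain L.carrier, ENNReal.ofReal (f z) ≤ ENNReal.ofReal C := by
  refine (lintegral_mono fun z ↦ ENNReal.ofReal_le_ofReal (h z)).trans ?_
  simp [volume_torusDomain]

/-- Comparison of mean values of bounded nonnegative functions. -/
theorem toReal_setLIntegral_le_add {L : UnimodularLattice m} {f g : (Fin m → ℝ) → ℝ} {ε C : ℝ}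
    (hε : 0 ≤ ε) (hg0 : ∀ z, 0 ≤ g z) (hgC : ∀ z, g z ≤ C) (h : ∀ z, f z ≤ g z + ε) :
    (∫⁻ z in torusDomain L.carrier, ENNReal.ofReal (f z)).toReal ≤
      (∫⁻ z in torusDomain L.carrier, ENNReal.ofReal (g z)).toReal + ε := by
  have hfin : ∫⁻ z in torusDomain L.carrier, ENNReal.ofReal (g z) ≠ ⊤ :=
    ((setLIntegral_ofReal_le hgC).trans_lt ENNReal.ofReal_lt_top).ne
  rw [← ENNReal.toReal_ofReal hε, ← ENNReal.toReal_add hfin ENNReal.ofReal_ne_top]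
  refine ENNReal.toReal_mono (ENNReal.add_ne_top.2 ⟨hfin, ENNReal.ofReal_ne_top⟩) ?_
  calc ∫⁻ z in torusDomain L.carrier, ENNReal.ofReal (f z)
      ≤ ∫⁻ z in torusDomain L.carrier, (ENNReal.ofReal (g z) + ENNReal.ofReal ε) := by
        refine lintegral_mono fun z ↦ ?_
        rw [← ENNReal.ofReal_add (hg0 z) hε]
        exact ENNReal.ofReal_le_ofReal (h z)
    _ = _ := by
        rw [lintegral_add_right _ measurable_const]
        simp [volume_torusDomain]

/-- Points in a shell around the origin, of radii between `r / 4` and `r / 2`, have cost at least `r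
/ 4`, and so do their lattice translates. -/
theorem meanCost_pos (hm : 0 < m) (σ : Sense) {α : ℝ} (hα : 0 < α) (L : UnimodularLattice m) :
    0 < meanCost σ α L := by
  obtain ⟨r, hr0, hr⟩ := exists_pos_le_ell1 L
  let O : Set (Fin m → ℝ) := {z | r / 4 < ell1 z ∧ ell1 z < r / 2}
  have hO : IsOpen O := (isOpen_lt continuous_const continuous_ell1).inter
    (isOpen_lt continuous_ell1 continuous_const)
  have hOne : O.Nonempty := by
    refine ⟨Pi.single (⟨0, hm⟩ : Fin m) (r / 3), ?_⟩
    simp only [O, Set.mem_ofPred_eq, ell1_single]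
    rw [abs_of_pos (by positivity)]
    constructor <;> linarith
  -- The chosen fundamental domain may miss the shell itself, but it meets this periodic open set in
  -- positive measure: an invariant set null in a fundamental domain is null.
  let P : Set (Fin m → ℝ) := ⋃ v : L.carrier, (v : Fin m → ℝ) +ᵥ O
  have hPo : IsOpen P := isOpen_iUnion fun v ↦ hO.vadd _
  have hP : ∀ z ∈ P, r / 4 ≤ cost L σ z := by
    intro z hz
    obtain ⟨v, hv⟩ := Set.mem_iUnion.1 hz
    obtain ⟨y, hy, rfl⟩ := hv
    simp only [vadd_eq_add]
    rw [cost_add v.2]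
    obtain ⟨w, hw, hc, h⟩ := exists_cost_eq L σ y
    rw [← h]
    exact hy.1.le.trans (le_ell1_add_of_mem hr hy.2.le hw)
  have hPD : volume (P ∩ torusDomain L.carrier) ≠ 0 := by
    intro h0
    have := (isAddFundamentalDomain_torusDomain L).measure_zero_of_invariant P (fun g ↦ ?_) h0
    · have hP0 : volume O = 0 := by
        refine measure_mono_null (fun z hz ↦ ?_) this
        exact Set.mem_iUnion.2 ⟨0, by simpa using hz⟩
      exact (hO.measure_pos volume hOne).ne' hP0
    · ext z
      simp only [P, Set.mem_vadd_set_iff_neg_vadd_mem, Set.mem_iUnion, Submodule.vadd_def,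
        vadd_eq_add]
      constructor
      · rintro ⟨v, hv⟩
        refine ⟨v + g, ?_⟩
        convert hv using 1
        push_cast
        abel
      · rintro ⟨v, hv⟩
        refine ⟨v - g, ?_⟩
        convert hv using 1
        push_cast
        abel
  have hlow : ENNReal.ofReal ((r / 4) ^ α) * volume (P ∩ torusDomain L.carrier) ≤
      ∫⁻ z in torusDomain L.carrier, ENNReal.ofReal (cost L σ z ^ α) := by
    rw [← Measure.restrict_apply hPo.measurableSet, ← lintegral_indicator_const hPo.measurableSet]
    refine lintegral_mono fun z ↦ ?_
    by_cases hz : z ∈ P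
    · rw [Set.indicator_of_mem hz]
      exact ENNReal.ofReal_le_ofReal
        (Real.rpow_le_rpow (by positivity) (hP z hz) hα.le)
    · simp [hz]
  have hpos : 0 < ENNReal.ofReal ((r / 4) ^ α) * volume (P ∩ torusDomain L.carrier) :=
    ENNReal.mul_pos (by simpa using Real.rpow_pos_of_pos (by positivity) α) hPD
  refine ENNReal.toReal_pos (hpos.trans_le hlow).ne' ?_
  refine ((setLIntegral_ofReal_le (C := (Parameter.diameter σ).onUnimodular L ^ α)
    fun z ↦ ?_).trans_lt ENNReal.ofReal_lt_top).ne
  exact Real.rpow_le_rpow (cost_nonneg _ _ _) (cost_le_diameter _ _ _) hα.le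

/-- Uniform continuity of `x ↦ x ^ α` on bounded sets. -/
theorem exists_rpow_le_rpow_add {α : ℝ} (hα : 0 < α) (T : ℝ) {ε : ℝ} (hε : 0 < ε) :
    ∃ η > 0, ∀ x y : ℝ, 0 ≤ x → x ≤ T → 0 ≤ y → y ≤ x + η → y ^ α ≤ x ^ α + ε := by
  have huc : UniformContinuousOn (fun x : ℝ ↦ x ^ α) (Set.Icc 0 (T + 1)) :=
    isCompact_Icc.uniformContinuousOn_of_continuous
      (Real.continuous_rpow_const hα.le).continuousOn
  obtain ⟨η, hη, h⟩ := Metric.uniformContinuousOn_iff.1 huc ε hε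
  -- The bound `1` keeps `y` inside the compact interval `[0, T + 1]`.
  refine ⟨min (η / 2) 1, by positivity, fun x y hx hxT hy hyx ↦ ?_⟩
  by_cases hxy : y ≤ x
  · linarith [Real.rpow_le_rpow hy hxy hα.le]
  · push Not at hxy
    have h1 := min_le_left (η / 2) 1
    have h2 := min_le_right (η / 2) 1
    have := h y ⟨hy, by linarith⟩ x ⟨hx, by linarith⟩ (by
      rw [Real.dist_eq, abs_of_pos (by linarith)]
      linarith)
    rw [Real.dist_eq] at this
    linarith [(abs_lt.1 this).2]

/-- Because `T` bounds all costs, one translation serves every `z`. The comparison is thus along a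
single measure-preserving affine map and can be integrated. -/
theorem cost_act_le {k : SpecialLinearGroup (Fin m) ℝ} {δ : ℝ} (hδ : 0 < δ)
    (hk : ∀ v i, |(k.1 *ᵥ v) i - v i| ≤ δ * ell1 v) {L : UnimodularLattice m} {σ : Sense} {T : ℝ}
    (hT : ∀ z, cost L σ z ≤ T) (z : Fin m → ℝ) :
    cost (act k L) σ (k.1 *ᵥ z + fun _ ↦ T * δ) ≤ cost L σ z + 2 * m * δ * T := by
  obtain ⟨v, hv, hc, h⟩ := exists_cost_eq L σ z
  obtain ⟨h1, h2⟩ := mulVec_add_mem_cone hδ hk hc (h.trans_le (hT z))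
  have hz : (k.1 *ᵥ (z + v) + fun _ ↦ T * δ) = (k.1 *ᵥ z + fun _ ↦ T * δ) + k.1 *ᵥ v := by
    rw [mulVec_add]
    abel
  rw [hz] at h1 h2
  rw [← h]
  exact (cost_le (mulVec_mem_act.2 hv) h1).trans h2

theorem continuous_meanCost (hm : 0 < m) (σ : Sense) {α : ℝ} (hα : 0 < α) :
    Continuous (meanCost σ α : UnimodularLattice m → ℝ) := by
  refine continuous_of_eventually_act_le hm (g := (Parameter.diameter σ).onUnimodular)
    (fun L ↦ (eventually_onUnimodular_diameter_act_le hm σ _ one_pos).mono fun _ hk ↦ hk L le_rfl)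
    fun T ε hε ↦ ?_
  obtain ⟨η, hη, hpow⟩ := exists_rpow_le_rpow_add hα T hε
  set T' := |T| + 1
  have hT' : 0 < 2 * m * T' := by positivity
  filter_upwards [eventually_abs_mulVec_sub_le (m := m) (δ := η / (2 * m * T')) (by positivity)]
    with k hk L hL
  have hcT : ∀ z, cost L σ z ≤ T := fun z ↦ (cost_le_diameter L σ z).trans hL
  have hcT' : ∀ z, cost L σ z ≤ T' := fun z ↦ (hcT z).trans (by linarith [le_abs_self T])
  have hT0 : 0 < T' := by positivity
  have hδ : 2 * m * (η / (2 * m * T')) * T' = η := by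
    field_simp
  have hcost := cost_act_le (by positivity) hk hcT'
  rw [hδ] at hcost
  rw [meanCost, ← setLIntegral_comp_affine k (fun _ ↦ T' * (η / (2 * m * T'))) L
    (fun v hv z ↦ by rw [cost_add hv])]
  refine toReal_setLIntegral_le_add (C := T ^ α) hε.le
    (fun z ↦ Real.rpow_nonneg (cost_nonneg _ _ _) _)
    (fun z ↦ Real.rpow_le_rpow (cost_nonneg _ _ _) (hcT z) hα.le) fun z ↦ ?_
  exact hpow _ _ (cost_nonneg _ _ _) (hcT z) (cost_nonneg _ _ _) (hcost z)

end Moment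

/-! ### Distances in Cayley graphs of quotients of `ℤ^m` -/

section Cayley

variable {m : ℕ}

/-- The `ℓ₁`-norm on `ℤ^m`. -/
def intNorm (w : Fin m → ℤ) : ℕ := ∑ i, (w i).natAbs

/-- The vectors of `ℤ^m` that are sums of steps along edges. -/
def intCone (m : ℕ) : Sense → Set (Fin m → ℤ)
  | .undirected => Set.univ
  | .directed => {w | ∀ i, 0 ≤ w i}

theorem intNorm_eq_zero {w : Fin m → ℤ} : intNorm w = 0 ↔ w = 0 := by
  simp [intNorm, funext_iff]

theorem intNorm_add_le (v w : Fin m → ℤ) : intNorm (v + w) ≤ intNorm v + intNorm w := by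
  rw [intNorm, intNorm, intNorm, ← Finset.sum_add_distrib]
  exact Finset.sum_le_sum fun i _ ↦ Int.natAbs_add_le _ _

theorem intNorm_single (i : Fin m) (s : ℤ) : intNorm (Pi.single i s) = s.natAbs := by
  rw [intNorm, Finset.sum_eq_single i] <;> simp +contextual

theorem intNorm_add_single {w : Fin m → ℤ} (hw : ∀ i, 0 ≤ w i) (i : Fin m) :
    intNorm (w + Pi.single i 1) = intNorm w + 1 := by
  rw [intNorm, intNorm, ← Finset.add_sum_erase _ _ (Finset.mem_univ i),
    ← Finset.add_sum_erase _ (fun i ↦ (w i).natAbs) (Finset.mem_univ i),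
    Finset.sum_congr rfl fun j hj ↦ show
      ((w + Pi.single i 1 : Fin m → ℤ) j).natAbs = (w j).natAbs by
        simp [Finset.ne_of_mem_erase hj]]
  have := hw i
  simp only [Pi.add_apply, Pi.single_eq_same]
  omega

/-- Peeling off one unit step is the induction step for building walks; the last clause keeps
directed walks inside the orthant. -/
theorem exists_intNorm_sub_single {w : Fin m → ℤ} {n : ℕ} (hw : intNorm w = n + 1) :
    ∃ (i : Fin m) (s : ℤ), (s = 1 ∨ s = -1) ∧ intNorm (w - Pi.single i s) = n ∧
      ((∀ j, 0 ≤ w j) → s = 1 ∧ ∀ j, 0 ≤ (w - Pi.single i s : Fin m → ℤ) j) := by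
  obtain ⟨i, hi⟩ : ∃ i, w i ≠ 0 := by
    by_contra! h
    rw [intNorm_eq_zero.2 (funext h)] at hw
    omega
  obtain ⟨s, hs, hsw, hs0⟩ : ∃ s : ℤ, (s = 1 ∨ s = -1) ∧ (w i - s).natAbs + 1 = (w i).natAbs ∧
      (0 ≤ w i → s = 1 ∧ 0 ≤ w i - s) := by
    rcases lt_or_gt_of_ne hi with h | h
    · exact ⟨-1, Or.inr rfl, by omega, by omega⟩
    · exact ⟨1, Or.inl rfl, by omega, by omega⟩
  refine ⟨i, s, hs, ?_, fun h ↦ ⟨(hs0 (h i)).1, fun j ↦ ?_⟩⟩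
  · rw [intNorm, ← Finset.add_sum_erase _ _ (Finset.mem_univ i)] at hw ⊢
    rw [Finset.sum_congr rfl fun j hj ↦ show
      ((w - Pi.single i s : Fin m → ℤ) j).natAbs = (w j).natAbs by
        simp [Finset.ne_of_mem_erase hj]]
    simp only [Pi.sub_apply, Pi.single_eq_same]
    omega
  · by_cases hj : j = i
    · subst hj
      simpa using (hs0 (h j)).2
    · simpa [hj] using h j

variable {Λ : AddSubgroup (Fin m → ℤ)}

local notation "π" => (QuotientAddGroup.mk : (Fin m → ℤ) → (Fin m → ℤ) ⧸ Λ)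

theorem mk_single_mem_standardGenerators (i : Fin m) :
    π (Pi.single i 1) ∈ standardGenerators Λ :=
  ⟨i, rfl⟩

theorem exists_isDirectedWalk_succ {V : Type*} {D : Digraph V} {n : ℕ} {x y : V} :
    (∃ p, IsDirectedWalk D p (n + 1) x y) ↔ ∃ z, (∃ p, IsDirectedWalk D p n x z) ∧ D.Adj z y := by
  constructor
  · rintro ⟨p, hx, hy, h⟩
    exact ⟨p n, ⟨p, hx, rfl, fun k hk ↦ h k (by omega)⟩, hy ▸ h n (by omega)⟩
  · rintro ⟨z, ⟨p, hx, hz, h⟩, hzy⟩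
    refine ⟨fun k ↦ if k ≤ n then p k else y, by simpa using hx, by simp, fun k hk ↦ ?_⟩
    rcases Nat.lt_succ_iff_lt_or_eq.1 hk with hk' | rfl
    · simpa [hk'.le, Nat.succ_le_of_lt hk'] using h k hk'
    · simpa [hz] using hzy

/-- Directed steps never cancel, so the length of a walk is exactly the norm of the vector it lifts
to. -/
theorem exists_isDirectedWalk_iff {n : ℕ} {x y : (Fin m → ℤ) ⧸ Λ} :
    (∃ p, IsDirectedWalk (cayleyDigraph (standardGenerators Λ)) p n x y) ↔
      ∃ w : Fin m → ℤ, (∀ i, 0 ≤ w i) ∧ x + π w = y ∧ intNorm w = n := by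
  induction n generalizing y with
  | zero =>
    constructor
    · rintro ⟨p, hx, hy, -⟩
      exact ⟨0, by simp, by rw [← hx, ← hy]; simp, intNorm_eq_zero.2 rfl⟩
    · rintro ⟨w, -, hw, h0⟩
      rw [intNorm_eq_zero.1 h0] at hw
      exact ⟨fun _ ↦ x, rfl, by simpa using hw, by simp⟩
  | succ n ih =>
    rw [exists_isDirectedWalk_succ]
    constructor
    · rintro ⟨z, hz, -, ⟨i, rfl⟩, h⟩
      obtain ⟨w, hw0, hw, hwn⟩ := ih.1 hz
      refine ⟨w + Pi.single i 1, fun j ↦ add_nonneg (hw0 j) ?_, ?_, ?_⟩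
      · rcases eq_or_ne j i with rfl | hj
        · simp
        · simp [hj]
      · rw [QuotientAddGroup.mk_add, ← add_assoc, hw, h]
      · rw [intNorm_add_single hw0, hwn]
    · rintro ⟨w, hw0, hw, hwn⟩
      obtain ⟨i, s, -, hn, h⟩ := exists_intNorm_sub_single hwn
      obtain ⟨rfl, h0⟩ := h hw0
      refine ⟨x + π (w - Pi.single i 1), ih.2 ⟨_, h0, rfl, hn⟩, _,
        mk_single_mem_standardGenerators i, ?_⟩
      rw [add_assoc, ← QuotientAddGroup.mk_add, sub_add_cancel, hw]

theorem exists_walk_length_le (w : Fin m → ℤ) (x : (Fin m → ℤ) ⧸ Λ) :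
    ∃ p : (SimpleGraph.addCayley (standardGenerators Λ)).Walk x (x + π w),
      p.length ≤ intNorm w := by
  obtain ⟨n, hn⟩ : ∃ n, intNorm w = n := ⟨_, rfl⟩
  induction n generalizing w with
  | zero =>
    rw [intNorm_eq_zero.1 hn]
    exact ⟨SimpleGraph.Walk.nil.copy rfl (by simp), by simp⟩
  | succ n ih =>
    obtain ⟨i, s, hs, hn', -⟩ := exists_intNorm_sub_single hn
    obtain ⟨p, hp⟩ := ih _ hn'
    have hstep : x + π (w - Pi.single i s) + π (Pi.single i s) = x + π w := by
      rw [add_assoc, ← QuotientAddGroup.mk_add, sub_add_cancel]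
    -- If the generator is trivial in the quotient, the step would be a loop, which a simple graph
    -- does not have; it is dropped. Hence only an inequality for the length.
    by_cases heq : x + π (w - Pi.single i s) = x + π w
    · exact ⟨p.copy rfl heq, by simp only [SimpleGraph.Walk.length_copy]; omega⟩
    · have hadj : (SimpleGraph.addCayley (standardGenerators Λ)).Adj
          (x + π (w - Pi.single i s)) (x + π w) := by
        rw [SimpleGraph.addCayley_adj']
        refine ⟨heq, _, mk_single_mem_standardGenerators i, ?_⟩
        rcases hs with rfl | rfl
        · exact Or.inl hstep
        · right
          rw [← hstep, add_assoc, ← QuotientAddGroup.mk_add, ← Pi.single_add]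
          simp
      exact ⟨p.concat hadj, by rw [SimpleGraph.Walk.length_concat]; omega⟩

theorem exists_intNorm_le_length {x y : (Fin m → ℤ) ⧸ Λ}
    (p : (SimpleGraph.addCayley (standardGenerators Λ)).Walk x y) :
    ∃ w : Fin m → ℤ, x + π w = y ∧ intNorm w ≤ p.length := by
  induction p with
  | nil => exact ⟨0, by simp, by simp [intNorm]⟩
  | cons h p ih =>
    obtain ⟨w, hw, hwn⟩ := ih
    rw [SimpleGraph.addCayley_adj'] at h
    obtain ⟨-, -, ⟨i, rfl⟩, h⟩ := h
    obtain ⟨s, hs, hs'⟩ : ∃ s : ℤ, s.natAbs = 1 ∧ _ + π (Pi.single i s) = _ := by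
      rcases h with h | h
      · exact ⟨1, rfl, h⟩
      · refine ⟨-1, rfl, ?_⟩
        rw [h, add_assoc, ← QuotientAddGroup.mk_add, ← Pi.single_add]
        simp
    refine ⟨Pi.single i s + w, ?_, ?_⟩
    · rw [QuotientAddGroup.mk_add, ← add_assoc, hs', hw]
    · refine (intNorm_add_le _ _).trans ?_
      rw [intNorm_single, SimpleGraph.Walk.length_cons]
      omega

theorem cayleyDist_le_intNorm {σ : Sense} {w : Fin m → ℤ} (hw : w ∈ intCone m σ)
    (x : (Fin m → ℤ) ⧸ Λ) : cayleyDist (standardGenerators Λ) σ x (x + π w) ≤ intNorm w := by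
  cases σ with
  | undirected =>
    obtain ⟨p, hp⟩ := exists_walk_length_le w x
    exact (SimpleGraph.dist_le p).trans hp
  | directed => exact Nat.sInf_le (exists_isDirectedWalk_iff.2 ⟨w, hw, rfl, rfl⟩)

/-- Adding multiples of the index to the coordinates does not change the class. This makes the
digraph strongly connected. -/
theorem exists_mk_eq_of_nonneg (hΛ : Λ.index ≠ 0) (q : (Fin m → ℤ) ⧸ Λ) :
    ∃ w : Fin m → ℤ, (∀ i, 0 ≤ w i) ∧ π w = q := by
  obtain ⟨w, rfl⟩ := QuotientAddGroup.mk_surjective q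
  refine ⟨w + Λ.index • fun i ↦ |w i|, fun i ↦ ?_, ?_⟩
  · have h1 : (1 : ℤ) ≤ Λ.index := by exact_mod_cast Nat.one_le_iff_ne_zero.2 hΛ
    have h2 := neg_abs_le (w i)
    have h3 := abs_nonneg (w i)
    rw [Pi.add_apply, Pi.smul_apply, nsmul_eq_mul]
    nlinarith
  · rw [QuotientAddGroup.mk_add, (QuotientAddGroup.eq_zero_iff _).2 (Λ.nsmul_index_mem _), add_zero]

/-- Connectedness is essential: between vertices joined by no walk the distance would take its
default value `0`. -/
theorem exists_intNorm_le_cayleyDist (hΛ : Λ.index ≠ 0) (σ : Sense) (x y : (Fin m → ℤ) ⧸ Λ) :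
    ∃ w ∈ intCone m σ, x + π w = y ∧ intNorm w ≤ cayleyDist (standardGenerators Λ) σ x y := by
  obtain ⟨w, hw0, hw⟩ := exists_mk_eq_of_nonneg hΛ (y - x)
  have hxy : x + π w = y := by rw [hw, add_sub_cancel]
  cases σ with
  | undirected =>
    obtain ⟨p, -⟩ := exists_walk_length_le w x
    have hr : (SimpleGraph.addCayley (standardGenerators Λ)).Reachable x y := ⟨p.copy rfl hxy⟩
    obtain ⟨p, hp⟩ := hr.exists_walk_length_eq_dist
    obtain ⟨w, hw, hwn⟩ := exists_intNorm_le_length p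
    exact ⟨w, Set.mem_univ _, hw, hwn.trans hp.le⟩
  | directed =>
    have hne : {n | ∃ p, IsDirectedWalk (cayleyDigraph (standardGenerators Λ)) p n x y}.Nonempty :=
      ⟨_, exists_isDirectedWalk_iff.2 ⟨w, hw0, hxy, rfl⟩⟩
    obtain ⟨w, hw0, hw, hwn⟩ := exists_isDirectedWalk_iff.1 (Nat.sInf_mem hne)
    exact ⟨w, hw0, hw, hwn.le⟩

theorem cayleyDist_eq_sub (hΛ : Λ.index ≠ 0) (σ : Sense) (x y : (Fin m → ℤ) ⧸ Λ) :
    cayleyDist (standardGenerators Λ) σ x y = cayleyDist (standardGenerators Λ) σ 0 (y - x) := by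
  refine le_antisymm ?_ ?_
  · obtain ⟨w, hw, h, hn⟩ := exists_intNorm_le_cayleyDist hΛ σ 0 (y - x)
    rw [zero_add] at h
    have := cayleyDist_le_intNorm hw x
    rw [h, add_sub_cancel] at this
    exact this.trans hn
  · obtain ⟨w, hw, h, hn⟩ := exists_intNorm_le_cayleyDist hΛ σ x y
    have := cayleyDist_le_intNorm hw (0 : (Fin m → ℤ) ⧸ Λ)
    rw [zero_add, eq_sub_of_add_eq' h] at this
    exact this.trans hn

end Cayley

/-! ### Comparison of the graph distance with the distance in the torus -/

section Comparison

variable {m : ℕ} {ℓ : ℕ+} (Λ : IndexSubgroup m ℓ)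

theorem index_ne_zero : Λ.1.index ≠ 0 := by
  rw [Λ.2]
  exact ℓ.ne_zero

theorem finite_quotient : Finite ((Fin m → ℤ) ⧸ Λ.1) :=
  Nat.finite_of_card_ne_zero (index_ne_zero Λ)

theorem card_quotient : Nat.card ((Fin m → ℤ) ⧸ Λ.1) = ℓ :=
  Λ.2

theorem onRescaled_rescale (P : Parameter) :
    P.onRescaled ℓ (rescale Λ) = scale m ℓ * P.onTorusGraph Λ.1 := by
  rw [Parameter.onRescaled, unscale_rescale]

/-- The graph distance from `0` to `q`. -/
def graphCost (σ : Sense) (q : (Fin m → ℤ) ⧸ Λ.1) : ℕ :=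
  cayleyDist (standardGenerators Λ.1) σ 0 q

variable (m ℓ) in
/-- The integral vector `k` such that `z` is in the half-open cube `ℓ^{-1/m} (k + (0,1]^m)`. -/
def roundDown (z : Fin m → ℝ) : Fin m → ℤ := fun i ↦ ⌈z i / scale m ℓ⌉ - 1

theorem scaleHom_apply (k : Fin m → ℤ) (i : Fin m) : scaleHom m ℓ k i = scale m ℓ * k i :=
  rfl

/-- Using the ceiling minus one rather than the floor makes the left inequality strict, so the
remainder lies in the open orthant, as the directed torus distance requires. -/
theorem roundDown_spec (z : Fin m → ℝ) (i : Fin m) :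
    scaleHom m ℓ (roundDown m ℓ z) i < z i ∧
      z i ≤ scaleHom m ℓ (roundDown m ℓ z) i + scale m ℓ := by
  have hs := scale_pos m ℓ
  have h1 := Int.le_ceil (z i / scale m ℓ)
  have h2 := Int.ceil_lt_add_one (z i / scale m ℓ)
  rw [div_le_iff₀ hs] at h1
  rw [← sub_lt_iff_lt_add, lt_div_iff₀ hs] at h2
  rw [scaleHom_apply, roundDown]
  push_cast
  constructor <;> linarith

theorem roundDown_scaleHom_add (k : Fin m → ℤ) (z : Fin m → ℝ) :
    roundDown m ℓ (scaleHom m ℓ k + z) = k + roundDown m ℓ z := by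
  ext i
  have : (scaleHom m ℓ k + z) i / scale m ℓ = k i + z i / scale m ℓ := by
    rw [Pi.add_apply, scaleHom_apply, add_div, mul_div_cancel_left₀ _ (scale_pos m ℓ).ne']
  rw [roundDown, this, Int.ceil_intCast_add, Pi.add_apply, roundDown]
  ring

theorem ell1_scaleHom (k : Fin m → ℤ) : ell1 (scaleHom m ℓ k) = scale m ℓ * intNorm k := by
  rw [ell1, intNorm]
  push_cast
  rw [Finset.mul_sum]
  refine Finset.sum_congr rfl fun i _ ↦ ?_
  rw [scaleHom_apply, abs_mul, abs_of_pos (scale_pos m ℓ), Nat.cast_natAbs, Int.cast_abs]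

/-- The vertex of the graph next to the point `z` of the torus. -/
def vertex (z : Fin m → ℝ) : (Fin m → ℤ) ⧸ Λ.1 := QuotientAddGroup.mk (roundDown m ℓ z)

theorem vertex_scaleHom_add (k : Fin m → ℤ) (z : Fin m → ℝ) :
    vertex Λ (scaleHom m ℓ k + z) = QuotientAddGroup.mk k + vertex Λ z := by
  rw [vertex, roundDown_scaleHom_add, QuotientAddGroup.mk_add]
  rfl

theorem vertex_surjective : Function.Surjective (vertex Λ) := by
  intro q
  obtain ⟨k, hk⟩ := QuotientAddGroup.mk_surjective (q - vertex Λ 0)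
  refine ⟨scaleHom m ℓ k + 0, ?_⟩
  rw [vertex_scaleHom_add, hk, sub_add_cancel]

theorem ell1_sub_roundDown_le (z : Fin m → ℝ) :
    ell1 (z - scaleHom m ℓ (roundDown m ℓ z)) ≤ m * scale m ℓ := by
  refine ell1_le_of_forall_le fun i ↦ ?_
  have := roundDown_spec (ℓ := ℓ) z i
  rw [Pi.sub_apply, abs_of_nonneg] <;> linarith

/-- A shortest graph path lifts to an integral vector `w`; together with the rounding remainder of
`z` it is a translate of `z` by an element of `Λ̄`, longer than the path by at most `m * scale m ℓ`.
-/
theorem cost_rescale_le (σ : Sense) (z : Fin m → ℝ) :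
    cost (rescale Λ) σ z ≤ scale m ℓ * graphCost Λ σ (vertex Λ z) + m * scale m ℓ := by
  obtain ⟨w, hw, h, hn⟩ := exists_intNorm_le_cayleyDist (index_ne_zero Λ) σ 0 (vertex Λ z)
  rw [zero_add] at h
  have hmem : w - roundDown m ℓ z ∈ Λ.1 := by
    rw [← QuotientAddGroup.eq_zero_iff, QuotientAddGroup.mk_sub, h]
    exact sub_self _
  have hz : z + scaleHom m ℓ (w - roundDown m ℓ z) =
      (z - scaleHom m ℓ (roundDown m ℓ z)) + scaleHom m ℓ w := by
    rw [map_sub]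
    abel
  have hc : z + scaleHom m ℓ (w - roundDown m ℓ z) ∈ cone m σ := by
    cases σ with
    | undirected => exact Set.mem_univ _
    | directed =>
      rw [hz]
      intro i
      have h1 := (roundDown_spec (ℓ := ℓ) z i).1
      have h2 : 0 ≤ scaleHom m ℓ w i :=
        mul_nonneg (scale_pos m ℓ).le (Int.cast_nonneg (hw i))
      simp only [Pi.add_apply, Pi.sub_apply]
      linarith
  have h1 := cost_le (mem_rescale.2 ⟨_, hmem, rfl⟩) hc
  rw [hz] at h1
  refine h1.trans ((ell1_add_le _ _).trans ?_)
  rw [ell1_scaleHom, add_comm]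
  have h2 : (intNorm w : ℝ) ≤ graphCost Λ σ (vertex Λ z) := by exact_mod_cast hn
  exact add_le_add (mul_le_mul_of_nonneg_left h2 (scale_pos m ℓ).le) (ell1_sub_roundDown_le z)

theorem le_cost_rescale (σ : Sense) (z : Fin m → ℝ) :
    scale m ℓ * graphCost Λ σ (vertex Λ z) ≤ cost (rescale Λ) σ z + m * scale m ℓ := by
  obtain ⟨v, hv, hc, h⟩ := exists_cost_eq (rescale Λ) σ z
  obtain ⟨k, hk, rfl⟩ := mem_rescale.1 hv
  have hmk : (QuotientAddGroup.mk (k + roundDown m ℓ z) : (Fin m → ℤ) ⧸ Λ.1) = vertex Λ z := by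
    rw [QuotientAddGroup.mk_add, (QuotientAddGroup.eq_zero_iff _).2 hk, zero_add]
    rfl
  have hz : scaleHom m ℓ (k + roundDown m ℓ z) =
      (z + scaleHom m ℓ k) + -(z - scaleHom m ℓ (roundDown m ℓ z)) := by
    rw [map_add]
    abel
  have hcone : k + roundDown m ℓ z ∈ intCone m σ := by
    cases σ with
    | undirected => exact Set.mem_univ _
    | directed =>
      intro i
      have h1 : 0 < (z + scaleHom m ℓ k) i := hc i
      have h2 := (roundDown_spec (ℓ := ℓ) z i).2
      have h3 := congrFun hz i
      rw [scaleHom_apply] at h3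
      simp only [Pi.add_apply, Pi.neg_apply, Pi.sub_apply] at h1 h3
      have h4 : -scale m ℓ < scale m ℓ * ((k i + roundDown m ℓ z i : ℤ) : ℝ) := by linarith
      -- Rounding a positive vector can only produce integer coordinates above `-1`, that is,
      -- nonnegative ones, so the open cone becomes the closed integral cone.
      have h5 : (-1 : ℝ) < ((k i + roundDown m ℓ z i : ℤ) : ℝ) := by
        by_contra! hle
        have := mul_le_mul_of_nonneg_left hle (scale_pos m ℓ).le
        linarith
      have h6 : (-1 : ℤ) < k i + roundDown m ℓ z i := by exact_mod_cast h5
      simp only [Pi.add_apply]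
      omega
  have hd := cayleyDist_le_intNorm hcone (0 : (Fin m → ℤ) ⧸ Λ.1)
  rw [zero_add, hmk] at hd
  have hd' : (graphCost Λ σ (vertex Λ z) : ℝ) ≤ intNorm (k + roundDown m ℓ z) := by
    exact_mod_cast hd
  refine (mul_le_mul_of_nonneg_left hd' (scale_pos m ℓ).le).trans ?_
  rw [← ell1_scaleHom, hz, ← h]
  refine (ell1_add_le _ _).trans ?_
  rw [ell1_neg]
  exact add_le_add_right (ell1_sub_roundDown_le z) _

theorem abs_onRescaled_sub_diameter_le (σ : Sense) :
    |(Parameter.diameter σ).onRescaled ℓ (rescale Λ) -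
      (Parameter.diameter σ).onUnimodular (rescale Λ)| ≤ m * scale m ℓ := by
  have := finite_quotient Λ
  have hs := scale_pos m ℓ
  set d : ℕ := ⨆ q : ((Fin m → ℤ) ⧸ Λ.1) × ((Fin m → ℤ) ⧸ Λ.1),
    cayleyDist (standardGenerators Λ.1) σ q.1 q.2
  have hd : (Parameter.diameter σ).onRescaled ℓ (rescale Λ) = scale m ℓ * d :=
    onRescaled_rescale Λ _
  rw [hd]
  have hle : ∀ q, graphCost Λ σ q ≤ d := fun q ↦
    le_ciSup (f := fun q : ((Fin m → ℤ) ⧸ Λ.1) × ((Fin m → ℤ) ⧸ Λ.1) ↦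
      cayleyDist (standardGenerators Λ.1) σ q.1 q.2) (Set.finite_range _).bddAbove (0, q)
  rw [abs_le]
  constructor
  · have h1 : (Parameter.diameter σ).onUnimodular (rescale Λ) ≤
        scale m ℓ * d + m * scale m ℓ := by
      -- The slack `ε` turns the bound on costs into the strict inequality of `Covers`.
      refine le_of_forall_pos_le_add fun ε hε ↦ onUnimodular_diameter_le fun z ↦ ?_
      obtain ⟨v, hv, hc, h⟩ := exists_cost_eq (rescale Λ) σ z
      refine ⟨v, hv, hc, ?_⟩
      have h2 := cost_rescale_le Λ σ z
      have h3 : (graphCost Λ σ (vertex Λ z) : ℝ) ≤ d := by exact_mod_cast hle _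
      have := mul_le_mul_of_nonneg_left h3 hs.le
      linarith
    linarith
  · obtain ⟨q, hq⟩ := exists_eq_ciSup_of_finite
      (f := fun q : ((Fin m → ℤ) ⧸ Λ.1) × ((Fin m → ℤ) ⧸ Λ.1) ↦
        cayleyDist (standardGenerators Λ.1) σ q.1 q.2)
    obtain ⟨z, hz⟩ := vertex_surjective Λ (q.2 - q.1)
    have h1 := le_cost_rescale Λ σ z
    rw [hz, graphCost, ← cayleyDist_eq_sub (index_ne_zero Λ)] at h1
    have h2 : cayleyDist (standardGenerators Λ.1) σ q.1 q.2 = d := hq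
    rw [h2] at h1
    linarith [cost_le_diameter (rescale Λ) σ z]

/-! ### Averages over the vertices as integrals over the torus. -/

theorem measurable_comp_vertex (f : (Fin m → ℤ) ⧸ Λ.1 → ℝ≥0∞) :
    Measurable fun z ↦ f (vertex Λ z) := by
  have h1 : Measurable (roundDown m ℓ) := by
    refine measurable_pi_lambda _ fun i ↦ ?_
    have : Measurable fun z : Fin m → ℝ ↦ ⌈z i / scale m ℓ⌉ :=
      Int.measurable_ceil.comp ((measurable_pi_apply i).div_const _)
    exact this.sub_const 1
  exact (Measurable.of_discrete (f := fun k : Fin m → ℤ ↦ f (QuotientAddGroup.mk k))).comp h1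

/-- Instead of computing the volumes of the fibres of `vertex`, the integrand is summed over all
translations of the group. Each is induced by a translation of the torus and leaves the integral
unchanged, while the sum is a constant function. -/
theorem setLIntegral_comp_vertex [Fintype ((Fin m → ℤ) ⧸ Λ.1)]
    (f : (Fin m → ℤ) ⧸ Λ.1 → ℝ≥0∞) :
    ℓ * ∫⁻ z in torusDomain (rescale Λ).carrier, f (vertex Λ z) = ∑ q, f q := by
  have hper : ∀ v ∈ (rescale Λ).carrier, ∀ z, f (vertex Λ (v + z)) = f (vertex Λ z) := by
    intro v hv z
    obtain ⟨k, hk, rfl⟩ := mem_rescale.1 hv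
    rw [vertex_scaleHom_add, (QuotientAddGroup.eq_zero_iff _).2 hk, zero_add]
  have h1 : ∀ a : (Fin m → ℤ) ⧸ Λ.1,
      ∫⁻ z in torusDomain (rescale Λ).carrier, f (a + vertex Λ z) =
        ∫⁻ z in torusDomain (rescale Λ).carrier, f (vertex Λ z) := by
    intro a
    obtain ⟨k, rfl⟩ := QuotientAddGroup.mk_surjective a
    rw [← setLIntegral_comp_add (rescale Λ) (f := fun z ↦ f (vertex Λ z)) hper (scaleHom m ℓ k)]
    simp_rw [add_comm _ (scaleHom m ℓ k), vertex_scaleHom_add]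
  have h2 : ∫⁻ z in torusDomain (rescale Λ).carrier, ∑ a, f (a + vertex Λ z) =
      ∑ a : (Fin m → ℤ) ⧸ Λ.1, ∫⁻ z in torusDomain (rescale Λ).carrier, f (vertex Λ z) := by
    rw [lintegral_finsetSum _ fun a _ ↦ measurable_comp_vertex Λ fun q ↦ f (a + q)]
    exact Finset.sum_congr rfl fun a _ ↦ h1 a
  rw [Finset.sum_const, Finset.card_univ, ← Nat.card_eq_fintype_card, card_quotient,
    nsmul_eq_mul] at h2
  rw [← h2]
  have h3 : ∀ z, ∑ a, f (a + vertex Λ z) = ∑ q, f q := fun z ↦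
    Equiv.sum_comp (Equiv.addRight (vertex Λ z)) f
  simp [h3, volume_torusDomain]

/-- The mean value of the `α`-th power of the rescaled graph distance. -/
def graphMean (σ : Sense) (α : ℝ) : ℝ :=
  (∫⁻ z in torusDomain (rescale Λ).carrier,
    ENNReal.ofReal ((scale m ℓ * graphCost Λ σ (vertex Λ z)) ^ α)).toReal

/-- Homogeneity of the graph reduces the double sum to a single one, and the factor `scale m ℓ`
enters the root as its `α`-th power. -/
theorem onRescaled_moment (σ : Sense) {α : ℝ} (hα : 0 < α) :
    (Parameter.moment σ α hα).onRescaled ℓ (rescale Λ) = graphMean Λ σ α ^ (1 / α) := by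
  have := finite_quotient Λ
  have := Fintype.ofFinite ((Fin m → ℤ) ⧸ Λ.1)
  have hs := scale_pos m ℓ
  have hℓ : (0 : ℝ) < (ℓ : ℕ) := by exact_mod_cast ℓ.pos
  have h1 : (Parameter.moment σ α hα).onRescaled ℓ (rescale Λ) = scale m ℓ *
      (((Nat.card ((Fin m → ℤ) ⧸ Λ.1) : ℝ) ^ 2)⁻¹ *
        ∑ᶠ q : ((Fin m → ℤ) ⧸ Λ.1) × ((Fin m → ℤ) ⧸ Λ.1),
          (cayleyDist (standardGenerators Λ.1) σ q.1 q.2 : ℝ) ^ α) ^ (1 / α) :=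
    onRescaled_rescale Λ _
  have h2 : ∑ᶠ q : ((Fin m → ℤ) ⧸ Λ.1) × ((Fin m → ℤ) ⧸ Λ.1),
      (cayleyDist (standardGenerators Λ.1) σ q.1 q.2 : ℝ) ^ α =
        (ℓ : ℕ) * ∑ q, (graphCost Λ σ q : ℝ) ^ α := by
    rw [finsum_eq_sum_of_fintype, Fintype.sum_prod_type]
    have : ∀ x : (Fin m → ℤ) ⧸ Λ.1,
        ∑ y, (cayleyDist (standardGenerators Λ.1) σ x y : ℝ) ^ α =
          ∑ q, (graphCost Λ σ q : ℝ) ^ α := by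
      intro x
      simp_rw [cayleyDist_eq_sub (index_ne_zero Λ) σ x]
      exact Equiv.sum_comp (Equiv.subRight x) fun q ↦ (graphCost Λ σ q : ℝ) ^ α
    simp_rw [this]
    rw [Finset.sum_const, Finset.card_univ, ← Nat.card_eq_fintype_card, card_quotient,
      nsmul_eq_mul]
  have h3 : graphMean Λ σ α = scale m ℓ ^ α * ((ℓ : ℕ) : ℝ)⁻¹ *
      ∑ q, (graphCost Λ σ q : ℝ) ^ α := by
    have h := setLIntegral_comp_vertex Λ fun q ↦
      ENNReal.ofReal ((scale m ℓ * graphCost Λ σ q) ^ α)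
    rw [← ENNReal.ofReal_sum_of_nonneg fun q _ ↦ by positivity] at h
    have h' := congrArg ENNReal.toReal h
    rw [ENNReal.toReal_mul, ENNReal.toReal_ofReal (Finset.sum_nonneg fun q _ ↦ by positivity)] at h'
    have h'' : ((ℓ : ℕ) : ℝ) * graphMean Λ σ α =
        ∑ q, (scale m ℓ * graphCost Λ σ q) ^ α := by simpa [graphMean] using h'
    simp_rw [Real.mul_rpow hs.le (Nat.cast_nonneg _)] at h''
    rw [← Finset.mul_sum] at h''
    rw [mul_right_comm, ← h'']
    field_simp
  have h4 : scale m ℓ = (scale m ℓ ^ α) ^ (1 / α) := by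
    rw [← Real.rpow_mul hs.le, mul_one_div_cancel hα.ne', Real.rpow_one]
  rw [h1, h2, h3, card_quotient]
  conv_lhs => rw [h4]
  rw [← Real.mul_rpow (by positivity) (by positivity)]
  congr 1
  field_simp

/-- On lattices of bounded covering radius the moments for the graphs are uniformly close to those
for the tori. -/
theorem exists_abs_onRescaled_sub_moment_le (m : ℕ) (σ : Sense) {α : ℝ} (hα : 0 < α) (T : ℝ)
    {δ : ℝ} (hδ : 0 < δ) : ∃ s₀ > 0, ∀ (ℓ : ℕ+) (Λ : IndexSubgroup m ℓ), scale m ℓ ≤ s₀ →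
      (Parameter.diameter σ).onUnimodular (rescale Λ) ≤ T →
        |(Parameter.moment σ α hα).onRescaled ℓ (rescale Λ) -
          (Parameter.moment σ α hα).onUnimodular (rescale Λ)| ≤ δ := by
  -- For mesh at most `1` this bounds both the torus cost and the rescaled graph cost, so uniform
  -- continuity of the power applies to both.
  set T' := T + m with hT'
  obtain ⟨ε, hε, hroot⟩ := exists_rpow_le_rpow_add (one_div_pos.2 hα) (T' ^ α) hδ
  obtain ⟨η, hη, hpow⟩ := exists_rpow_le_rpow_add hα T' hε
  refine ⟨min 1 (η / (m + 1)), by positivity, fun ℓ Λ hs hT ↦ ?_⟩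
  have hs0 := scale_pos m ℓ
  have hs1 : m * scale m ℓ ≤ m :=
    mul_le_of_le_one_right (Nat.cast_nonneg _) (hs.trans (min_le_left _ _))
  have hs2 : m * scale m ℓ ≤ η := by
    have := hs.trans (min_le_right _ _)
    rw [le_div_iff₀ (by positivity)] at this
    linarith
  have hc0 := cost_nonneg (rescale Λ) σ
  have hcT : ∀ z, cost (rescale Λ) σ z ≤ T' := fun z ↦ by
    linarith [cost_le_diameter (rescale Λ) σ z, Nat.cast_nonneg (α := ℝ) m]
  have hg0 : ∀ z, 0 ≤ scale m ℓ * graphCost Λ σ (vertex Λ z) := fun z ↦ by positivity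
  have hgT : ∀ z, scale m ℓ * graphCost Λ σ (vertex Λ z) ≤ T' := fun z ↦ by
    linarith [cost_le_diameter (rescale Λ) σ z, le_cost_rescale Λ σ z]
  have hb : ∀ f : (Fin m → ℝ) → ℝ, (∀ z, 0 ≤ f z) → (∀ z, f z ≤ T') →
      (∫⁻ z in torusDomain (rescale Λ).carrier, ENNReal.ofReal (f z ^ α)).toReal ≤ T' ^ α := by
    intro f hf0 hfT
    have h0 : 0 ≤ T' := (hf0 0).trans (hfT 0)
    rw [← ENNReal.toReal_ofReal (Real.rpow_nonneg h0 α)]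
    exact ENNReal.toReal_mono ENNReal.ofReal_ne_top
      (setLIntegral_ofReal_le fun z ↦ Real.rpow_le_rpow (hf0 z) (hfT z) hα.le)
  have h1 : graphMean Λ σ α ≤ meanCost σ α (rescale Λ) + ε :=
    toReal_setLIntegral_le_add (C := T' ^ α) hε.le (fun z ↦ Real.rpow_nonneg (hc0 z) _)
      (fun z ↦ Real.rpow_le_rpow (hc0 z) (hcT z) hα.le)
      fun z ↦ hpow _ _ (hc0 z) (hcT z) (hg0 z) (by linarith [le_cost_rescale Λ σ z])
  have h2 : meanCost σ α (rescale Λ) ≤ graphMean Λ σ α + ε :=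
    toReal_setLIntegral_le_add (C := T' ^ α) hε.le (fun z ↦ Real.rpow_nonneg (hg0 z) _)
      (fun z ↦ Real.rpow_le_rpow (hg0 z) (hgT z) hα.le)
      fun z ↦ hpow _ _ (hg0 z) (hgT z) (hc0 z) (by linarith [cost_rescale_le Λ σ z])
  have h3 := hroot _ _ ENNReal.toReal_nonneg (hb _ hc0 hcT) ENNReal.toReal_nonneg h1
  have h4 := hroot _ _ ENNReal.toReal_nonneg (hb _ hg0 hgT) ENNReal.toReal_nonneg h2
  rw [onRescaled_moment, onUnimodular_moment, abs_le]
  change meanCost σ α (rescale Λ) ^ (1 / α) ≤ graphMean Λ σ α ^ (1 / α) + δ at h4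
  change graphMean Λ σ α ^ (1 / α) ≤ meanCost σ α (rescale Λ) ^ (1 / α) + δ at h3
  constructor <;> linarith

end Comparison

/-! ### The girth -/

section Girth

variable {m : ℕ}

theorem onUnimodular_girth_lt_iff (hm : 0 < m) {L : UnimodularLattice m} {t : ℝ} :
    Parameter.girth.onUnimodular L < t ↔ ∃ v ∈ L.carrier, (∀ i, 0 < v i) ∧ ell1 v < t := by
  change sInf {t : ℝ | 0 < t ∧ ∃ v ∈ L.carrier, v ≠ 0 ∧ v ∈ t • ball m .directed} < t ↔ _
  have hmem : ∀ {v : Fin m → ℝ} {a : ℝ}, v ∈ L.carrier → (∀ i, 0 < v i) → ell1 v < a →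
      a ∈ {t : ℝ | 0 < t ∧ ∃ v ∈ L.carrier, v ≠ 0 ∧ v ∈ t • ball m .directed} := by
    intro v a hv hpos hlt
    have ha : 0 < a := (ell1_nonneg v).trans_lt hlt
    refine ⟨ha, v, hv, ?_, (mem_smul_ball ha).2 ⟨hpos, hlt⟩⟩
    rintro rfl
    exact lt_irrefl _ (hpos ⟨0, hm⟩)
  constructor
  · intro h
    -- Covering the origin by a directed ball yields a lattice vector in the open orthant, so the
    -- infimum is not the default value `0` of an empty set.
    have hne : {t : ℝ | 0 < t ∧ ∃ v ∈ L.carrier, v ≠ 0 ∧ v ∈ t • ball m .directed}.Nonempty := by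
      obtain ⟨t, ht⟩ := exists_covers L .directed
      obtain ⟨v, hv, hc, hlt⟩ := ht 0
      rw [zero_add] at hc hlt
      exact ⟨t, hmem hv hc hlt⟩
    obtain ⟨t', ⟨ht', v, hv, -, hb⟩, hlt⟩ := exists_lt_of_csInf_lt hne h
    rw [mem_smul_ball ht'] at hb
    exact ⟨v, hv, hb.1, hb.2.trans hlt⟩
  · rintro ⟨v, hv, hpos, hlt⟩
    obtain ⟨a, ha, hat⟩ := exists_between hlt
    exact (csInf_le ⟨0, fun _ h ↦ h.1.le⟩ (hmem hv hpos ha)).trans_lt hat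

theorem onUnimodular_girth_pos (hm : 0 < m) (L : UnimodularLattice m) :
    0 < Parameter.girth.onUnimodular L := by
  obtain ⟨r, hr0, hr⟩ := exists_pos_le_ell1 L
  refine hr0.trans_le (le_of_forall_gt fun t ht ↦ ?_)
  obtain ⟨v, hv, hpos, hlt⟩ := (onUnimodular_girth_lt_iff hm).1 ht
  refine (hr v hv ?_).trans_lt hlt
  rintro rfl
  exact lt_irrefl _ (hpos ⟨0, hm⟩)

/-- Upper semicontinuity holds everywhere: a short vector in the open orthant stays there under
small perturbations. -/
theorem isOpen_onUnimodular_girth_lt (hm : 0 < m) (t : ℝ) :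
    IsOpen {L : UnimodularLattice m | Parameter.girth.onUnimodular L < t} := by
  rw [isOpen_iff_mem_nhds]
  intro L hL
  obtain ⟨v, hv, hpos, hlt⟩ := (onUnimodular_girth_lt_iff hm).1 hL
  have hO : IsOpen {v : Fin m → ℝ | (∀ i, 0 < v i) ∧ ell1 v < t} := by
    have hpos : IsOpen {v : Fin m → ℝ | ∀ i, 0 < v i} := by
      simp only [Set.ofPred_forall]
      exact isOpen_iInter_of_finite fun i ↦ isOpen_lt continuous_const (continuous_apply i)
    exact hpos.inter (isOpen_lt continuous_ell1 continuous_const)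
  refine (eventually_nhds_iff hm).2 ?_
  filter_upwards [(tendsto_mulVec v).eventually (hO.mem_nhds ⟨hpos, hlt⟩)] with k hk
  exact (onUnimodular_girth_lt_iff hm).2 ⟨_, mulVec_mem_act.2 hv, hk⟩

theorem measurable_onUnimodular_girth (hm : 0 < m) :
    Measurable (Parameter.girth.onUnimodular : UnimodularLattice m → ℝ) :=
  measurable_of_Iio fun t ↦ (isOpen_onUnimodular_girth_lt hm t).measurableSet

variable (m) in
/-- The lattices with girth less than `R` that have no nonzero vector of norm at most `R` in a
coordinate hyperplane. -/
def regularBelow (R : ℝ) : Set (UnimodularLattice m) :=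
  {L | Parameter.girth.onUnimodular L < R} \ ⋃ i, degenerate R i

theorem isOpen_regularBelow (hm : 0 < m) (R : ℝ) : IsOpen (regularBelow m R) :=
  (isOpen_onUnimodular_girth_lt hm R).sdiff
    (isClosed_iUnion_of_finite fun i ↦ isClosed_degenerate hm R i)

/-- In a regular lattice the short vectors of the closed orthant lie in the open one. -/
theorem onUnimodular_girth_le_of_nonneg (hm : 0 < m) {L : UnimodularLattice m} {R : ℝ}
    (hL : L ∈ regularBelow m R) {v : Fin m → ℝ} (hv : v ∈ L.carrier) (hv0 : v ≠ 0)
    (hpos : ∀ i, 0 ≤ v i) : Parameter.girth.onUnimodular L ≤ ell1 v := by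
  by_contra! hlt
  have hR : ell1 v ≤ R := (hlt.trans hL.1).le
  have hne : ∀ i, 0 < v i := fun i ↦ lt_of_le_of_ne (hpos i) fun h ↦
    hL.2 (Set.mem_iUnion.2 ⟨i, v, hv, hv0, hR, h.symm⟩)
  exact lt_irrefl _ ((onUnimodular_girth_lt_iff hm).2 ⟨v, hv, hne, hlt⟩)

/-- Lower semicontinuity uses regularity: below the girth, even the compact truncated closed orthant
contains no nonzero lattice vector, and this persists nearby. Without it, a boundary vector could
move into the open orthant and lower the girth abruptly. -/
theorem continuousOn_onUnimodular_girth (hm : 0 < m) (R : ℝ) :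
    ContinuousOn (Parameter.girth.onUnimodular : UnimodularLattice m → ℝ) (regularBelow m R) := by
  intro L hL
  refine ContinuousAt.continuousWithinAt (tendsto_order.2 ⟨fun a ha ↦ ?_, fun a ha ↦
    (isOpen_onUnimodular_girth_lt hm a).mem_nhds ha⟩)
  obtain ⟨b, hab, hb⟩ := exists_between ha
  have hK : IsCompact {v : Fin m → ℝ | (∀ i, 0 ≤ v i) ∧ ell1 v ≤ b} := by
    refine isCompact_of_isClosed_of_ell1_le (R := b) ?_ fun v hv ↦ hv.2
    have hpos : IsClosed {v : Fin m → ℝ | ∀ i, 0 ≤ v i} := by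
      simp only [Set.ofPred_forall]
      exact isClosed_iInter fun i ↦ isClosed_le continuous_const (continuous_apply i)
    exact hpos.inter (isClosed_le continuous_ell1 continuous_const)
  have hLK : ∀ v ∈ L.carrier, v ∈ {v : Fin m → ℝ | (∀ i, 0 ≤ v i) ∧ ell1 v ≤ b} → v = 0 := by
    intro v hv hvK
    by_contra hv0
    have := onUnimodular_girth_le_of_nonneg hm hL hv hv0 hvK.1
    linarith [hvK.2]
  refine (eventually_nhds_iff hm).2 ?_
  filter_upwards [eventually_forall_mem_act_eq_zero hK hLK] with k hk
  refine hab.trans_le (not_lt.1 fun hlt ↦ ?_)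
  obtain ⟨v, hv, hpos, hvb⟩ := (onUnimodular_girth_lt_iff hm).1 hlt
  have h0 := hk v hv ⟨fun i ↦ (hpos i).le, hvb.le⟩
  have := hpos ⟨0, hm⟩
  rw [h0] at this
  exact lt_irrefl _ this

/-- The sublevel sets of the finite functional exhaust the space, and removing the degenerate
lattices costs no measure. -/
theorem exists_le_measureReal_regularBelow (hm : 0 < m) {mX : Measure (UnimodularLattice m)}
    [IsProbabilityMeasure mX] (hmX : ∀ g : SpecialLinearGroup (Fin m) ℝ, mX.map (act g) = mX)
    {ε : ℝ} (hε : 0 < ε) : ∃ R, 1 - ε ≤ mX.real (regularBelow m R) := by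
  have hnull : ∀ R, mX.real (regularBelow m R) =
      mX.real {L | Parameter.girth.onUnimodular L < R} := by
    intro R
    rw [measureReal_def, measureReal_def, regularBelow, measure_sdiff_null]
    exact measure_iUnion_null fun i ↦ measure_degenerate hm hmX R i
  have hmono : Monotone fun n : ℕ ↦
      {L : UnimodularLattice m | Parameter.girth.onUnimodular L < n} := by
    intro a b hab L hL
    exact lt_of_lt_of_le (show _ < (a : ℝ) from hL) (by exact_mod_cast hab)
  have hU : ⋃ n : ℕ, {L : UnimodularLattice m | Parameter.girth.onUnimodular L < n} = Set.univ := by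
    refine Set.eq_univ_of_forall fun L ↦ ?_
    obtain ⟨n, hn⟩ := exists_nat_gt (Parameter.girth.onUnimodular L)
    exact Set.mem_iUnion.2 ⟨n, hn⟩
  have hlim := tendsto_measure_iUnion_atTop (μ := mX) hmono
  rw [hU, measure_univ] at hlim
  have hlim' := (ENNReal.tendsto_toReal ENNReal.one_ne_top).comp hlim
  rw [ENNReal.toReal_one] at hlim'
  obtain ⟨n, hn⟩ := ((tendsto_order.1 hlim').1 (1 - ε) (by linarith)).exists
  exact ⟨n, (hnull n).symm ▸ hn.le⟩

/-- A shortest closed walk is a cycle. -/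
theorem directedGirth_eq {V : Type*} (D : Digraph V) :
    directedGirth D = sInf {n | 0 < n ∧ ∃ (x : V) (p : ℕ → V), IsDirectedWalk D p n x x} := by
  set B := {n | 0 < n ∧ ∃ (x : V) (p : ℕ → V), IsDirectedWalk D p n x x} with hB
  set A := {n | 0 < n ∧ ∃ (x : V) (p : ℕ → V), IsDirectedWalk D p n x x ∧
    Set.InjOn p (Set.Iio n)} with hA
  change sInf A = sInf B
  have hAB : A ⊆ B := fun n ⟨hn, x, p, hp, _⟩ ↦ ⟨hn, x, p, hp⟩
  rcases B.eq_empty_or_nonempty with hBe | hBne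
  · rw [Set.subset_eq_empty hAB hBe, hBe]
  have hbA : sInf B ∈ A := by
    obtain ⟨hpos, x, p, hp0, hpn, hp⟩ := Nat.sInf_mem hBne
    refine ⟨hpos, x, p, ⟨hp0, hpn, hp⟩, ?_⟩
    -- A repeated vertex would cut out a strictly shorter closed walk.
    have key : ∀ i j, i < j → j < sInf B → p i ≠ p j := by
      intro i j hij hj heq
      have hmem : j - i ∈ B := by
        refine ⟨by omega, p i, fun k ↦ p (i + k), rfl, ?_, fun k hk ↦ hp (i + k) (by omega)⟩
        change p (i + (j - i)) = p i
        rw [Nat.add_sub_cancel' hij.le, heq]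
      have := Nat.sInf_le hmem
      omega
    intro i hi j hj hij
    rcases lt_trichotomy i j with h | h | h
    · exact absurd hij (key i j h hj)
    · exact h
    · exact absurd hij.symm (key j i h hi)
  exact le_antisymm (Nat.sInf_le hbA) (Nat.sInf_le (hAB (Nat.sInf_mem ⟨_, hbA⟩)))

theorem directedGirth_cayleyDigraph {Λ : AddSubgroup (Fin m → ℤ)} :
    directedGirth (cayleyDigraph (standardGenerators Λ)) =
      sInf {n | ∃ w ∈ Λ, w ≠ 0 ∧ (∀ i, 0 ≤ w i) ∧ intNorm w = n} := by
  rw [directedGirth_eq]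
  congr 1
  ext n
  constructor
  · rintro ⟨hn, x, hp⟩
    obtain ⟨w, hw0, hw, hwn⟩ := exists_isDirectedWalk_iff.1 hp
    refine ⟨w, (QuotientAddGroup.eq_zero_iff _).1 (by simpa using hw), ?_, hw0, hwn⟩
    rintro rfl
    rw [intNorm_eq_zero.2 rfl] at hwn
    omega
  · rintro ⟨w, hw, hne, hw0, hwn⟩
    refine ⟨hwn ▸ Nat.pos_of_ne_zero fun h ↦ hne (intNorm_eq_zero.1 h), 0,
      exists_isDirectedWalk_iff.2 ⟨w, hw0, ?_, hwn⟩⟩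
    rw [zero_add, (QuotientAddGroup.eq_zero_iff _).2 hw]

/-- Closed walks correspond to nonzero vectors of `Λ` in the closed orthant. For a regular lattice
those on the boundary are too long to matter, so no discretization error arises. -/
theorem onRescaled_girth_eq (hm : 0 < m) {ℓ : ℕ+} {Λ : IndexSubgroup m ℓ} {R : ℝ}
    (hΛ : rescale Λ ∈ regularBelow m R) :
    Parameter.girth.onRescaled ℓ (rescale Λ) = Parameter.girth.onUnimodular (rescale Λ) := by
  have h : Parameter.girth.onRescaled ℓ (rescale Λ) =
      scale m ℓ * (directedGirth (cayleyDigraph (standardGenerators Λ.1)) : ℝ) :=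
    onRescaled_rescale Λ _
  rw [h, directedGirth_cayleyDigraph]
  have hs := scale_pos m ℓ
  refine le_antisymm (le_of_forall_gt fun t ht ↦ ?_) ?_
  · obtain ⟨v, hv, hpos, hlt⟩ := (onUnimodular_girth_lt_iff hm).1 ht
    obtain ⟨w, hw, rfl⟩ := mem_rescale.1 hv
    have hwpos : ∀ i, 0 < w i := fun i ↦ by
      have := hpos i
      rw [scaleHom_apply] at this
      exact_mod_cast (pos_iff_pos_of_mul_pos this).1 hs
    have hle := Nat.sInf_le (s := {n | ∃ w ∈ Λ.1, w ≠ 0 ∧ (∀ i, 0 ≤ w i) ∧ intNorm w = n})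
      ⟨w, hw, fun h ↦ (hwpos ⟨0, hm⟩).ne' (congrFun h _), fun i ↦ (hwpos i).le, rfl⟩
    rw [ell1_scaleHom] at hlt
    refine (mul_le_mul_of_nonneg_left ?_ hs.le).trans_lt hlt
    exact_mod_cast hle
  -- The index times `(1, …, 1)` lies in `Λ`, so the girth is attained rather than being the default
  -- value `0`.
  · have hne : {n | ∃ w ∈ Λ.1, w ≠ 0 ∧ (∀ i, 0 ≤ w i) ∧ intNorm w = n}.Nonempty := by
      refine ⟨_, _, Λ.1.nsmul_index_mem (fun _ ↦ 1), fun h ↦ ?_, fun i ↦ ?_, rfl⟩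
      · have := congrFun h ⟨0, hm⟩
        simp [index_ne_zero Λ] at this
      · simp
    obtain ⟨w, hw, hw0, hpos, hwn⟩ := Nat.sInf_mem hne
    rw [← hwn, ← ell1_scaleHom]
    refine onUnimodular_girth_le_of_nonneg hm hΛ (mem_rescale.2 ⟨w, hw, rfl⟩) ?_ fun i ↦ ?_
    · intro h
      exact hw0 (scaleHom_injective m ℓ (h.trans (map_zero _).symm))
    · exact mul_nonneg hs.le (Int.cast_nonneg (hpos i))

end Girth

/-! ### The limit theorem -/

section Limit

variable {m : ℕ}

theorem onUnimodular_pos (hm : 0 < m) (ξ : Parameter) (L : UnimodularLattice m) :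
    0 < ξ.onUnimodular L := by
  cases ξ with
  | diameter σ => exact onUnimodular_diameter_pos hm L σ
  | moment σ α hα =>
    rw [onUnimodular_moment]
    exact Real.rpow_pos_of_pos (meanCost_pos hm σ hα L) _
  | girth => exact onUnimodular_girth_pos hm L

theorem continuous_onUnimodular_moment (hm : 0 < m) (σ : Sense) {α : ℝ} (hα : 0 < α) :
    Continuous ((Parameter.moment σ α hα).onUnimodular : UnimodularLattice m → ℝ) := by
  have h : ((Parameter.moment σ α hα).onUnimodular : UnimodularLattice m → ℝ) =
      fun L ↦ meanCost σ α L ^ (1 / α) := funext (onUnimodular_moment σ hα)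
  rw [h]
  exact (Real.continuous_rpow_const (one_div_pos.2 hα).le).comp (continuous_meanCost hm σ hα)

theorem measurable_onUnimodular (hm : 0 < m) (ξ : Parameter) :
    Measurable (ξ.onUnimodular : UnimodularLattice m → ℝ) := by
  cases ξ with
  | diameter σ => exact (continuous_onUnimodular_diameter hm σ).measurable
  | moment σ α hα => exact (continuous_onUnimodular_moment hm σ hα).measurable
  | girth => exact measurable_onUnimodular_girth hm

/-- On compact subsets of a large open set, on which the functional is continuous, the metric
parameter of the graphs is uniformly close to the functional. -/
theorem exists_isOpen_continuousOn_uniform (hm : 0 < m) {mX : Measure (UnimodularLattice m)}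
    [IsProbabilityMeasure mX] (hmX : ∀ g : SpecialLinearGroup (Fin m) ℝ, mX.map (act g) = mX)
    (ξ : Parameter) {ε : ℝ} (hε : 0 < ε) :
    ∃ U : Set (UnimodularLattice m), IsOpen U ∧ 1 - ε ≤ mX.real U ∧ ContinuousOn ξ.onUnimodular U ∧
      ∀ K ⊆ U, IsCompact K → ∀ δ > 0, ∃ s₀ > 0, ∀ (ℓ : ℕ+) (Λ : IndexSubgroup m ℓ),
        scale m ℓ ≤ s₀ → rescale Λ ∈ K →
          |ξ.onRescaled ℓ (rescale Λ) - ξ.onUnimodular (rescale Λ)| ≤ δ := by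
  cases ξ with
  | diameter σ =>
    refine ⟨Set.univ, isOpen_univ, by simpa using hε.le,
      (continuous_onUnimodular_diameter hm σ).continuousOn, fun K _ _ δ hδ ↦
        ⟨δ / m, by positivity, fun ℓ Λ hs _ ↦ (abs_onRescaled_sub_diameter_le Λ σ).trans ?_⟩⟩
    rw [le_div_iff₀ (by positivity)] at hs
    linarith
  | moment σ α hα =>
    refine ⟨Set.univ, isOpen_univ, by simpa using hε.le,
      (continuous_onUnimodular_moment hm σ hα).continuousOn, fun K _ hK δ hδ ↦ ?_⟩
    obtain ⟨T, hT⟩ := (hK.image (continuous_onUnimodular_diameter hm σ)).bddAbove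
    obtain ⟨s₀, hs₀, h⟩ := exists_abs_onRescaled_sub_moment_le m σ hα T hδ
    exact ⟨s₀, hs₀, fun ℓ Λ hs hΛ ↦ h ℓ Λ hs (hT ⟨_, hΛ, rfl⟩)⟩
  | girth =>
    obtain ⟨R, hR⟩ := exists_le_measureReal_regularBelow hm hmX hε
    refine ⟨regularBelow m R, isOpen_regularBelow hm R, hR, continuousOn_onUnimodular_girth hm R,
      fun K hK _ δ hδ ↦ ⟨1, one_pos, fun ℓ Λ _ hΛ ↦ ?_⟩⟩
    rw [onRescaled_girth_eq hm (hK hΛ), sub_self, abs_zero]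
    exact hδ.le

end Limit

end TorusGraph

end

open TorusGraph
theorem mainTheorem3 (m : ℕ) (hm : 2 ≤ m)
    (mX : Measure (UnimodularLattice m)) [IsProbabilityMeasure mX]
    (hmX : ∀ g : Matrix.SpecialLinearGroup (Fin m) ℝ, mX.map (act g) = mX)
    (ℓ : ℕ → ℕ+) (𝒜 : (i : ℕ) → Finset (IndexSubgroup m (ℓ i))) (h𝒜 : ∀ i, (𝒜 i).Nonempty)
    (hconv : WeakStarTendsto (fun i ↦ familyMeasure (𝒜 i) (h𝒜 i)) mX)
    (ξ : Parameter) :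
    (∀ L : UnimodularLattice m, 0 < ξ.onUnimodular L) ∧
      TendstoInDistribution (fun i ↦ (ξ.onRescaled (ℓ i) : UnimodularLattice m → ℝ)) atTop
        (ξ.onUnimodular : UnimodularLattice m → ℝ)
        (fun i ↦ familyMeasure (𝒜 i) (h𝒜 i)) mX := by
  have hm0 : 0 < m := by omega
  have := t2Space_unimodularLattice hm0
  have := locallyCompactSpace_unimodularLattice hm0
  refine ⟨onUnimodular_pos hm0 ξ, ?_⟩
  refine tendstoInDistribution_of_weakStarTendsto (s := fun i ↦ rescaledFamily (𝒜 i))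
    (fun i ↦ rescaledFamily_nonempty (h𝒜 i)) hconv (measurable_onUnimodular hm0 ξ) fun ε hε ↦ ?_
  -- Half of `ε` is spent on passing to `U`, the other half on a compact subset of it.
  obtain ⟨U, hU, hμU, hcont, hunif⟩ := exists_isOpen_continuousOn_uniform hm0 hmX ξ (half_pos hε)
  obtain ⟨K, hKU, hK, hμK⟩ := exists_isCompact_subset_measureReal_ge hm0 mX hU (half_pos hε)
  refine ⟨U, K, hU, hK, hKU, by linarith, hcont, fun K' hK'U hK' δ hδ ↦ ?_⟩
  obtain ⟨s₀, hs₀, h⟩ := hunif K' hK'U hK' δ hδ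
  filter_upwards [(tendsto_order.1 (tendsto_scale hm hmX h𝒜 hconv)).2 s₀ hs₀] with i hi x hx hxK
  obtain ⟨Λ, -, rfl⟩ := Finset.mem_map.1 hx
  exact h (ℓ i) Λ hi.le hxK
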